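/- Call randomized real RAM the following unit-cost model. An input consists of integers $d,m\ge 0$, a matrix $B\in\mathbb{R}^{d\times d}$ and reals $f_0,\dots,f_{m-1}$; its numbers are read one at a time by random access. The memory consists of arrays of nonnegative integers and arrays of reals, initially zero. A program is a finite text without real constants that does not depend on the input; it is built from assignments by sequencing, if-then-else, and loops whose number of rounds is computed on entry. Each of the following costs one unit: an integer constant, reading an input number or a memory cell, an addition, truncated subtraction or comparison of nonnegative integers, an operation $+,-,\times,/$ (with $x/0=0$) or an exact comparison of reals, turning an integer into a real, evaluating $\cos(2\pi f_j t)$ or $\sin(2\pi f_j t)$ for integers $0\le j<m$, $0\le t<d$, writing a memory cell, drawing a uniformly random element of $\{0,\dots,n-1\}$ for a given integer $n$, and entering or repeating a loop. For a finite set $M=\{f_0,\dots,f_{m-1}\}\subset[0,1]$ of $m$ distinct frequencies let $F_M\in\mathbb{C}^{d\times m}$ be the Fourier matrix with entries $(F_M)_{t,j}=e^{2\pi i f_j t}$, $0\le t<d$, $0\le j<m$, let $F_M^*$ be its Hermitian transpose, and let $\|\cdot\|_F$ be the Frobenius norm. **Lemma.** There are a randomized real RAM program, an absolute constant $C$ and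 a polynomial $p$ such that the following holds for all $d,m$, every $B\in\mathbb{R}^{d\times d}$ and every set $M\subset[0,1]$ with $|M|=m$ (listed in any order). On input $(d,m,B,M)$ the program always stops after at most $p(m)$ units of time (independently of $d$ and $B$) and returns the diagonal of a real diagonal matrix $D'\in\mathbb{R}^{m\times m}$; the minimum below is attained, and with probability at least $0.99$ over the random choices of the program $$\|B-F_MD'F_M^*\|_F\;\le\; C\cdot\min_{D\in\mathbb{R}^{m\times m}\text{ diagonal}}\|B-F_MDF_M^*\|_F .$$ -/

import Mathlib

/-! ### Fourier matrices and the diagonal regression cost -/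

/-- The Fourier matrix `F_M ∈ ℂ^{d × m}` of the frequencies `f 0, …, f (m - 1)`: its `j`-th column is
`(1, e^{2πi f_j}, e^{2πi 2 f_j}, …, e^{2πi (d-1) f_j})`. -/
noncomputable def fourierMatrix (d : ℕ) {m : ℕ} (f : Fin m → ℝ) : Matrix (Fin d) (Fin m) ℂ :=
  fun t j => Complex.exp (2 * Real.pi * Complex.I * (f j : ℂ) * ((t : ℕ) : ℂ))

section Cost
open scoped Matrix.Norms.Frobenius Matrix

/-- `‖B - F_M D F_M^*‖_F`, where `D` is the real diagonal matrix with diagonal `D 0, …, D (m - 1)`. -/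
noncomputable def regressionCost {d m : ℕ} (B : Matrix (Fin d) (Fin d) ℝ) (f : Fin m → ℝ)
    (D : Fin m → ℝ) : ℝ :=
  ‖B.map (fun x : ℝ => (x : ℂ)) - fourierMatrix d f *
    (Matrix.diagonal D).map (fun x : ℝ => (x : ℂ)) * (fourierMatrix d f)ᴴ‖

end Cost

/-! ### The machine model

A randomized real RAM with unit costs, presented as a small structured programming language.
Programs are finite and contain no real constants, so that one program serves all inputs.

The input consists of `d`, `m`, a matrix `B ∈ ℝ^{d × d}` and frequencies `f 0, …, f (m - 1)`; it is
read through unit-cost random access. Integers only admit addition, truncated subtraction and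
comparison; reals admit `+, -, *, /` and exact comparison. There is no rounding of reals to integers.
The only transcendental operation is the evaluation of the real or imaginary part of
`e^{2πi f_j t}`, for an input frequency `f_j` and an integer `0 ≤ t < d`. The only source of
randomness is the drawing of a uniform integer in `{0, …, n - 1}`.

The work space consists of integer arrays `I_k[i]` and real arrays `R_k[i, j]`, where the name `k` of
an array is fixed in the program and the indices are computed at run time. -/

/-- Integer expressions. -/
inductive IntExpr where
  /-- an integer constant -/
  | lit (n : ℕ)
  /-- the input `d` -/
  | dim
  /-- the input `m` -/
  | card
  /-- the cell `I_k[i]` -/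
  | cell (k : ℕ) (i : IntExpr)
  | plus (a b : IntExpr)
  /-- truncated subtraction -/
  | minus (a b : IntExpr)

/-- Real expressions. -/
inductive RealExpr where
  /-- an integer, as a real number -/
  | ofInt (a : IntExpr)
  /-- the cell `R_k[i, j]` -/
  | cell (k : ℕ) (i j : IntExpr)
  /-- the input entry `B_{i, j}` -/
  | entry (i j : IntExpr)
  /-- the input frequency `f_j` -/
  | freq (j : IntExpr)
  /-- `cos (2 π f_j t)` for `j < m` and `t < d` -/
  | cosine (t j : IntExpr)
  /-- `sin (2 π f_j t)` for `j < m` and `t < d` -/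
  | sine (t j : IntExpr)
  | plus (x y : RealExpr)
  | minus (x y : RealExpr)
  | times (x y : RealExpr)
  | quot (x y : RealExpr)

/-- Tests. -/
inductive Test where
  | intLE (a b : IntExpr)
  | realLE (x y : RealExpr)

/-- Programs. -/
inductive Program where
  /-- `I_k[i] := a` -/
  | setInt (k : ℕ) (i a : IntExpr)
  /-- `R_k[i, j] := x` -/
  | setReal (k : ℕ) (i j : IntExpr) (x : RealExpr)
  /-- `I_k[i] :=` a uniform random element of `{0, …, a - 1}` -/
  | sample (k : ℕ) (i a : IntExpr)
  /-- `p; q` -/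
  | seq (p q : Program)
  /-- `if c then p else q` -/
  | cond (c : Test) (p q : Program)
  /-- execute `p` as often as the value that `a` has on entry -/
  | loop (a : IntExpr) (p : Program)

/-- The contents of the work space: `ints k i` is `I_k[i]` and `reals k i j` is `R_k[i, j]`. -/
structure Memory where
  ints : ℕ → ℕ → ℕ
  reals : ℕ → ℕ → ℕ → ℝ

/-- The initial work space. -/
def Memory.init : Memory where
  ints := fun _ _ => 0
  reals := fun _ _ _ => 0

/-- The work space after `I_k[i] := n`. -/
def Memory.writeInt (σ : Memory) (k i n : ℕ) : Memory where
  ints := Function.update σ.ints k (Function.update (σ.ints k) i n)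
  reals := σ.reals

/-- The work space after `R_k[i, j] := x`. -/
noncomputable def Memory.writeReal (σ : Memory) (k i j : ℕ) (x : ℝ) : Memory where
  ints := σ.ints
  reals := Function.update σ.reals k
    (Function.update (σ.reals k) i (Function.update (σ.reals k i) j x))

/-- The number of operations in an integer expression. -/
def IntExpr.cost : IntExpr → ℕ
  | lit _ => 1
  | dim => 1
  | card => 1
  | cell _ i => i.cost + 1
  | plus a b => a.cost + b.cost + 1
  | minus a b => a.cost + b.cost + 1

/-- The number of operations in a real expression. -/
def RealExpr.cost : RealExpr → ℕ
  | ofInt a => a.cost + 1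
  | cell _ i j => i.cost + j.cost + 1
  | entry i j => i.cost + j.cost + 1
  | freq j => j.cost + 1
  | cosine t j => t.cost + j.cost + 1
  | sine t j => t.cost + j.cost + 1
  | plus x y => x.cost + y.cost + 1
  | minus x y => x.cost + y.cost + 1
  | times x y => x.cost + y.cost + 1
  | quot x y => x.cost + y.cost + 1

/-- The number of operations in a test. -/
def Test.cost : Test → ℕ
  | intLE a b => a.cost + b.cost + 1
  | realLE x y => x.cost + y.cost + 1

/-- The value of an integer expression. -/
def IntExpr.eval (d m : ℕ) (σ : Memory) : IntExpr → ℕ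
  | lit n => n
  | dim => d
  | card => m
  | cell k i => σ.ints k (i.eval d m σ)
  | plus a b => a.eval d m σ + b.eval d m σ
  | minus a b => a.eval d m σ - b.eval d m σ

/-- The value of a real expression; input accesses that are out of range give `0`. -/
noncomputable def RealExpr.eval {d m : ℕ} (B : Matrix (Fin d) (Fin d) ℝ) (f : Fin m → ℝ)
    (σ : Memory) : RealExpr → ℝ
  | ofInt a => (a.eval d m σ : ℝ)
  | cell k i j => σ.reals k (i.eval d m σ) (j.eval d m σ)
  | entry i j =>
      if h : i.eval d m σ < d ∧ j.eval d m σ < d then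
        B ⟨i.eval d m σ, h.1⟩ ⟨j.eval d m σ, h.2⟩ else 0
  | freq j => if h : j.eval d m σ < m then f ⟨j.eval d m σ, h⟩ else 0
  | cosine t j =>
      if h : t.eval d m σ < d ∧ j.eval d m σ < m then
        Real.cos (2 * Real.pi * f ⟨j.eval d m σ, h.2⟩ * (t.eval d m σ : ℝ)) else 0
  | sine t j =>
      if h : t.eval d m σ < d ∧ j.eval d m σ < m then
        Real.sin (2 * Real.pi * f ⟨j.eval d m σ, h.2⟩ * (t.eval d m σ : ℝ)) else 0
  | plus x y => x.eval B f σ + y.eval B f σ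
  | minus x y => x.eval B f σ - y.eval B f σ
  | times x y => x.eval B f σ * y.eval B f σ
  | quot x y => x.eval B f σ / y.eval B f σ

/-- Whether a test succeeds. -/
def Test.Holds {d m : ℕ} (B : Matrix (Fin d) (Fin d) ℝ) (f : Fin m → ℝ) (σ : Memory) : Test → Prop
  | intLE a b => a.eval d m σ ≤ b.eval d m σ
  | realLE x y => x.eval B f σ ≤ y.eval B f σ

/-- The uniform distribution on `{0, …, n - 1}` (for `n = 0`, the point mass at `0`). -/
noncomputable def uniformBelow (n : ℕ) : PMF ℕ :=
  if h : n = 0 then PMF.pure 0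
  else PMF.uniformOfFinset (Finset.range n) (Finset.nonempty_range_iff.mpr h)

/-- `n` executions of `body` in a row, with the accumulated running time; every execution costs one
more unit for the loop counter. -/
noncomputable def iterateTimed (body : Memory → PMF (Memory × ℕ)) : ℕ → Memory → PMF (Memory × ℕ)
  | 0, σ => PMF.pure (σ, 0)
  | n + 1, σ => (body σ).bind fun o =>
      (iterateTimed body n o.1).bind fun o' => PMF.pure (o'.1, o.2 + 1 + o'.2)

open Classical in
/-- The joint distribution of the final work space and the running time of a program that is started
on the input `(d, m, B, f)` with a given work space. -/
noncomputable def Program.run {d m : ℕ} (B : Matrix (Fin d) (Fin d) ℝ) (f : Fin m → ℝ) :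
    Program → Memory → PMF (Memory × ℕ)
  | setInt k i a, σ =>
      PMF.pure (σ.writeInt k (i.eval d m σ) (a.eval d m σ), i.cost + a.cost + 1)
  | setReal k i j x, σ =>
      PMF.pure (σ.writeReal k (i.eval d m σ) (j.eval d m σ) (x.eval B f σ),
        i.cost + j.cost + x.cost + 1)
  | sample k i a, σ =>
      (uniformBelow (a.eval d m σ)).bind fun n =>
        PMF.pure (σ.writeInt k (i.eval d m σ) n, i.cost + a.cost + 1)
  | seq p q, σ => (p.run B f σ).bind fun o =>
      (q.run B f o.1).bind fun o' => PMF.pure (o'.1, o.2 + o'.2)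
  | cond c p q, σ =>
      (if c.Holds B f σ then p.run B f σ else q.run B f σ).bind fun o =>
        PMF.pure (o.1, c.cost + o.2)
  | loop a p, σ => (iterateTimed (p.run B f) (a.eval d m σ) σ).bind fun o =>
      PMF.pure (o.1, a.cost + 1 + o.2)

/-- The result of a program on the input `(d, m, B, f)`: the joint distribution of the output
`(R_0[0, 0], …, R_0[m - 1, 0])` and the running time. -/
noncomputable def Program.result (p : Program) {d m : ℕ} (B : Matrix (Fin d) (Fin d) ℝ)
    (f : Fin m → ℝ) : PMF ((Fin m → ℝ) × ℕ) :=
  (p.run B f Memory.init).map fun o => (fun j : Fin m => o.1.reals 0 j 0, o.2)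

/-!
The regression problem has one row per position `(s, t)` of `B`, with the entries `e^{2πi f_j (s - t)}`
and the target `B_{s, t}`. The program draws `poly m` positions uniformly at random, forms the real
Gram matrix of the sampled columns (including the target), and solves the sampled least squares
problem exactly.

**Uniform sampling suffices.** The square of an exponential sum with `m` frequencies at a point
`s - t` of the square is at most `400 (m + 1)^9` times its average over the square
(`norm_exponentialSum_sq_mul_le`), whatever `d` and the gaps between the frequencies. This rests on a
polynomial of degree at most `(m + 1)^3` with constant coefficient `1` that vanishes at `m` given
points `ζ` of the unit circle and whose coefficients have `ℓ²`-norm at most `5`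
(`exists_annihilating_coefficients`): the product of the factors `(1 - w) ∑_{k < n} (r w)^k` with
`w = z / ζ`. On the circle `|1 - w| / |1 - r w| ≤ 2 / (1 + r)`, so each factor is at most
`1 + O(1 / m)` if `r = 1 - O(1 / m)`, and the product is bounded; Parseval's identity bounds its
coefficients. Applied along arithmetic progressions of all possible steps inside the square, the
resulting linear recurrence compares a single value with the average.

**Accuracy.** In coordinates that are orthonormal for the average over the square, the sampled Gram
matrix is a sum of independent matrices with mean the identity and entries at most `400 (m + 1)^9`.
A second moment bound, in the form of a potential that grows slowly in every round
(`sum_deviationPotential_le`, `Program.expectation_loop_le`), shows that with high probability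
sampling loses at most half of the squared norm of every element of the range of the design map. By
Markov's inequality the sampled cost of an optimal diagonal is with high probability at most `200`
times its expected value. Together with Pythagoras for the sampled problem this gives the factor `21`
(`regressionCost_le_of_deviationPotential_lt_one`).

**Solving the sampled problem.** Gaussian elimination without pivoting on `[G | 1]` computes the
coefficients of the residual of the target (`eliminate_invariant`). The columns may be linearly
dependent, but since `G` is a Gram matrix, a zero pivot comes with a zero column below it, so that the
convention `x / 0 = 0` makes the elimination step do the right thing.

Running times and invariants are established by a small program logic (`Program.Ensures`), expected
values by `Program.expectation`.
-/

/-! ### Polynomials with prescribed zeros on the unit circle -/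

open Polynomial in
/-- The factor `(1 - w) ∑_{k < n} (r w)^k`, at `w = z / ζ`, as a polynomial in `z`; `u` is `ζ⁻¹`. -/
noncomputable def annihilatorFactor (r : ℝ) (n : ℕ) (u : ℂ) : Polynomial ℂ :=
  (1 - C u * X) * ∑ k ∈ Finset.range n, (C (r * u) * X) ^ k

theorem annihilatorFactor_eval (r : ℝ) (n : ℕ) (u z : ℂ) :
    (annihilatorFactor r n u).eval z
      = (1 - u * z) * ∑ k ∈ Finset.range n, ((r : ℂ) * (u * z)) ^ k := by
  simp [annihilatorFactor, Polynomial.eval_finsetSum, mul_assoc]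

theorem natDegree_annihilatorFactor_le (r : ℝ) {n : ℕ} (hn : 1 ≤ n) (u : ℂ) :
    (annihilatorFactor r n u).natDegree ≤ n := by
  have h1 : (1 - Polynomial.C u * Polynomial.X : Polynomial ℂ).natDegree ≤ 1 := by
    compute_degree
  have h2 : (∑ k ∈ Finset.range n,
      (Polynomial.C ((r : ℂ) * u) * Polynomial.X) ^ k : Polynomial ℂ).natDegree ≤ n - 1 := by
    refine Polynomial.natDegree_sum_le_of_forall_le _ _ fun k hk => ?_
    have hk' : k ≤ n - 1 := by have := Finset.mem_range.1 hk; omega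
    refine le_trans Polynomial.natDegree_pow_le (le_trans ?_ hk')
    have : (Polynomial.C ((r : ℂ) * u) * Polynomial.X : Polynomial ℂ).natDegree ≤ 1 := by
      compute_degree
    nlinarith
  calc _ ≤ _ := Polynomial.natDegree_mul_le
    _ ≤ 1 + (n - 1) := add_le_add h1 h2
    _ = n := by omega

/-- On the unit circle `(1 + r) |1 - w| ≤ 2 |1 - r w|`, because `|r - w| = |1 - r w|`. -/
theorem norm_one_sub_le_of_norm_eq_one {r : ℝ} (hr : 0 ≤ r) {w : ℂ} (hw : ‖w‖ = 1) :
    (1 + r) * ‖1 - w‖ ≤ 2 * ‖1 - (r : ℂ) * w‖ := by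
  have h1 : ((1 + r : ℝ) : ℂ) * (1 - w) = (1 - (r : ℂ) * w) + ((r : ℂ) - w) := by
    push_cast; ring
  have h2 : ‖(r : ℂ) - w‖ = ‖1 - (r : ℂ) * w‖ := by
    have hw2 : w.re * w.re + w.im * w.im = 1 := by
      rw [← Complex.normSq_apply, Complex.normSq_eq_norm_sq, hw]; norm_num
    rw [← sq_eq_sq₀ (norm_nonneg _) (norm_nonneg _), ← Complex.normSq_eq_norm_sq,
      ← Complex.normSq_eq_norm_sq, Complex.normSq_apply, Complex.normSq_apply]
    simp
    linear_combination (1 - r ^ 2) * hw2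
  calc (1 + r) * ‖1 - w‖ = ‖((1 + r : ℝ) : ℂ) * (1 - w)‖ := by
        rw [norm_mul, Complex.norm_real, Real.norm_of_nonneg (by linarith)]
    _ ≤ _ := by rw [h1]; refine (norm_add_le _ _).trans ?_; rw [h2]; linarith

theorem norm_annihilatorFactor_eval_le {r : ℝ} (hr : 0 ≤ r) (hr1 : r < 1) (n : ℕ) {u z : ℂ}
    (hu : ‖u‖ = 1) (hz : ‖z‖ = 1) :
    ‖(annihilatorFactor r n u).eval z‖ ≤ 2 / (1 + r) * (1 + r ^ n) := by
  have hw : ‖u * z‖ = 1 := by rw [norm_mul, hu, hz, one_mul]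
  rw [annihilatorFactor_eval]
  generalize u * z = w at hw
  have hrw : ‖(r : ℂ) * w‖ = r := by
    rw [norm_mul, hw, Complex.norm_real, Real.norm_of_nonneg hr, mul_one]
  have hne : (r : ℂ) * w ≠ 1 := fun h => by rw [h, norm_one] at hrw; linarith
  have hpos : 0 < ‖1 - (r : ℂ) * w‖ := norm_pos_iff.2 (sub_ne_zero.2 hne.symm)
  rw [geom_sum_eq hne, norm_mul, norm_div, norm_sub_rev _ (1 : ℂ), norm_sub_rev _ (1 : ℂ)]
  have h1 := norm_one_sub_le_of_norm_eq_one hr hw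
  have h2 : ‖1 - ((r : ℂ) * w) ^ n‖ ≤ 1 + r ^ n := by
    refine (norm_sub_le _ _).trans ?_
    rw [norm_pow, hrw, norm_one]
  have h3 : ‖1 - w‖ / ‖1 - (r : ℂ) * w‖ ≤ 2 / (1 + r) := by
    rw [div_le_div_iff₀ hpos (by linarith)]; linarith
  calc ‖1 - w‖ * (‖1 - ((r : ℂ) * w) ^ n‖ / ‖1 - (r : ℂ) * w‖)
      = ‖1 - w‖ / ‖1 - (r : ℂ) * w‖ * ‖1 - ((r : ℂ) * w) ^ n‖ := by ring
    _ ≤ _ := by gcongr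

/-- Any `m` points of the unit circle are roots of a polynomial of degree at most `(m + 1) ^ 3` whose
constant coefficient is `1` and whose coefficients have `ℓ²`-norm at most `5`. -/
theorem exists_annihilating_coefficients {m : ℕ} (z : Fin m → ℂ) (hz : ∀ i, ‖z i‖ = 1) :
    ∃ c : ℕ → ℂ, c 0 = 1 ∧ ∑ l ∈ Finset.range ((m + 1) ^ 3 + 1), ‖c l‖ ^ 2 ≤ 25 ∧
      ∀ i, ∑ l ∈ Finset.range ((m + 1) ^ 3 + 1), c l * z i ^ l = 0 := by
  -- the ratio `r` is chosen so that `(2 / (1 + r)) ^ m` and `(1 + r ^ n) ^ m` are both bounded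
  set M : ℕ := m + 1 with hM
  set r : ℝ := (M : ℝ) / (M + 1) with hr
  have hMpos : (1 : ℝ) ≤ M := by rw [hM]; push_cast; linarith [Nat.cast_nonneg (α := ℝ) m]
  have hr0 : 0 ≤ r := by positivity
  have hr1 : r < 1 := by rw [hr, div_lt_one (by positivity)]; linarith
  set n : ℕ := M ^ 2 with hn
  have hn1 : 1 ≤ n := Nat.one_le_pow _ _ (by omega)
  set Q : Polynomial ℂ := ∏ i, annihilatorFactor r n (z i)⁻¹ with hQ
  have hdeg : Q.natDegree < M ^ 3 + 1 := by
    have : Q.natDegree ≤ ∑ i : Fin m, n :=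
      (Polynomial.natDegree_prod_le _ _).trans
        (Finset.sum_le_sum fun i _ => natDegree_annihilatorFactor_le r hn1 _)
    simp at this
    have : m * n ≤ M ^ 3 := by rw [hn, hM]; nlinarith [Nat.zero_le ((m + 1) ^ 2)]
    omega
  have hrn : r ^ n ≤ 1 / M := by
    have h1 : r = (1 + 1 / (M : ℝ))⁻¹ := by rw [hr]; field_simp
    have h2 : 1 + (n : ℝ) * (1 / M) ≤ (1 + 1 / (M : ℝ)) ^ n :=
      one_add_mul_le_pow (by have : (0 : ℝ) ≤ 1 / M := by positivity
                             linarith) n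
    have h3 : (n : ℝ) * (1 / M) = M := by rw [hn]; push_cast; field_simp
    rw [h3] at h2
    rw [h1, inv_pow, ← one_div]
    exact one_div_le_one_div_of_le (by linarith) (by linarith)
  have hfac : 2 / (1 + r) * (1 + r ^ n) ≤ Real.exp (3 / 2 / M) := by
    have h1 : 2 / (1 + r) ≤ Real.exp (1 / 2 / M) := by
      refine le_trans ?_ (Real.add_one_le_exp _)
      rw [div_le_iff₀ (by linarith), hr]
      have : (1 / 2 / (M : ℝ) + 1) * (1 + M / (M + 1)) - 2 = 1 / (2 * M * (M + 1)) := by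
        field_simp; ring
      have : 0 ≤ 1 / (2 * (M : ℝ) * (M + 1)) := by positivity
      linarith
    have h2 : 1 + r ^ n ≤ Real.exp (1 / M) := by
      linarith [Real.add_one_le_exp (1 / (M : ℝ))]
    calc _ ≤ Real.exp (1 / 2 / M) * Real.exp (1 / M) := by gcongr
      _ = _ := by rw [← Real.exp_add]; congr 1; ring
  have hsup : ∀ w : ℂ, ‖w‖ = 1 → ‖Q.eval w‖ ≤ 5 := by
    intro w hw
    rw [hQ, Polynomial.eval_prod, norm_prod]
    calc ∏ i, ‖(annihilatorFactor r n (z i)⁻¹).eval w‖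
        ≤ ∏ _i : Fin m, Real.exp (3 / 2 / M) := by
          refine Finset.prod_le_prod (fun _ _ => norm_nonneg _) fun i _ => ?_
          exact (norm_annihilatorFactor_eval_le hr0 hr1 n (by simp [hz]) hw).trans hfac
      _ = Real.exp (m * (3 / 2 / M)) := by
          rw [Finset.prod_const, Finset.card_univ, Fintype.card_fin, ← Real.exp_nat_mul]
      _ ≤ Real.exp (3 / 2) := by
          apply Real.exp_le_exp.2
          rw [mul_div_assoc', div_le_iff₀ (by linarith)]
          have : (m : ℝ) ≤ M := by rw [hM]; push_cast; linarith
          nlinarith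
      _ ≤ 5 := by
          have h := Real.exp_one_lt_d9
          have h2 : Real.exp (3 / 2) ^ 2 = Real.exp 1 ^ 3 := by
            rw [← Real.exp_nat_mul, ← Real.exp_nat_mul]; norm_num
          have h3 : Real.exp 1 ^ 3 ≤ 2.72 ^ 3 := by gcongr; linarith
          nlinarith [Real.exp_pos (3 / 2 : ℝ)]
  refine ⟨Q.coeff, ?_, ?_, fun i => ?_⟩
  · rw [Polynomial.coeff_zero_eq_eval_zero, hQ, Polynomial.eval_prod]
    refine Finset.prod_eq_one fun i _ => ?_
    rw [annihilatorFactor_eval]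
    simp only [mul_zero, sub_zero, one_mul]
    rw [Finset.sum_eq_single_of_mem 0 (Finset.mem_range.2 hn1)]
    · simp
    · intro k _ hk; simp [hk]
  · have h1 : ∑ l ∈ Finset.range (M ^ 3 + 1), ‖Q.coeff l‖ ^ 2
        = ∑ l ∈ Q.support, ‖Q.coeff l‖ ^ 2 := by
      symm
      refine Finset.sum_subset ?_ ?_
      · intro l hl
        exact Finset.mem_range.2 (lt_of_le_of_lt (Polynomial.le_natDegree_of_mem_supp l hl) hdeg)
      · intro l _ hl
        simp [Polynomial.notMem_support_iff.1 hl]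
    rw [h1, Polynomial.sum_sq_norm_coeff_eq_circleAverage]
    refine Real.circleAverage_mono_on_of_le_circle ?_ fun w hw => ?_
    · apply ContinuousOn.circleIntegrable'
      fun_prop
    · have : ‖w‖ = 1 := by simpa using hw
      have := hsup w this
      nlinarith [norm_nonneg (Q.eval w)]
  · rw [← Polynomial.eval_eq_sum_range' hdeg, hQ, Polynomial.eval_prod]
    refine Finset.prod_eq_zero (Finset.mem_univ i) ?_
    have : z i ≠ 0 := by rw [← norm_pos_iff, hz]; norm_num
    rw [annihilatorFactor_eval, inv_mul_cancel₀ this]; simp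

/-! ### Values of exponential sums -/

/-- The exponential sum `x ↦ ∑ j, D j e^{2πi f_j x}` on the integers. -/
noncomputable def exponentialSum {m : ℕ} (f D : Fin m → ℝ) (x : ℤ) : ℂ :=
  ∑ j, (D j : ℂ) * Complex.exp (2 * Real.pi * Complex.I * (f j : ℂ) * (x : ℂ))

/-- A value of an exponential sum is controlled by the values on an arithmetic progression of `poly m`
terms starting next to it, with any step `θ`. -/
theorem norm_exponentialSum_sq_le {m : ℕ} (f D : Fin m → ℝ) (x θ : ℤ) :
    ‖exponentialSum f D x‖ ^ 2 ≤
      25 * ∑ l ∈ Finset.range ((m + 1) ^ 3), ‖exponentialSum f D (x + (l + 1 : ℕ) * θ)‖ ^ 2 := by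
  obtain ⟨c, hc0, hc, hz⟩ := exists_annihilating_coefficients
    (fun j : Fin m => Complex.exp (2 * Real.pi * Complex.I * (f j : ℂ) * (θ : ℂ))) (fun j => by
      rw [show 2 * (Real.pi : ℂ) * Complex.I * (f j : ℂ) * (θ : ℂ)
        = ((2 * Real.pi * f j * θ : ℝ) : ℂ) * Complex.I by push_cast; ring]
      exact Complex.norm_exp_ofReal_mul_I _)
  set N := (m + 1) ^ 3
  have hsum : ∑ l ∈ Finset.range (N + 1), c l * exponentialSum f D (x + (l : ℕ) * θ) = 0 := by
    simp only [exponentialSum, Finset.mul_sum]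
    rw [Finset.sum_comm]
    refine Finset.sum_eq_zero fun j _ => ?_
    rw [← mul_zero ((D j : ℂ) * Complex.exp (2 * Real.pi * Complex.I * (f j : ℂ) * (x : ℂ))),
      ← hz j, Finset.mul_sum]
    refine Finset.sum_congr rfl fun l _ => ?_
    rw [← Complex.exp_nat_mul]
    push_cast
    rw [mul_add, Complex.exp_add]
    ring_nf
  rw [Finset.sum_range_succ', hc0] at hsum
  rw [Finset.sum_range_succ'] at hc
  have hx : exponentialSum f D x
      = - ∑ l ∈ Finset.range N, c (l + 1) * exponentialSum f D (x + (l + 1 : ℕ) * θ) := by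
    rw [eq_neg_iff_add_eq_zero, add_comm, ← hsum]
    simp
  rw [hx, norm_neg]
  have h1 : ‖∑ l ∈ Finset.range N, c (l + 1) * exponentialSum f D (x + (l + 1 : ℕ) * θ)‖ ≤
      ∑ l ∈ Finset.range N, ‖c (l + 1)‖ * ‖exponentialSum f D (x + (l + 1 : ℕ) * θ)‖ :=
    (norm_sum_le _ _).trans (le_of_eq (by simp only [norm_mul]))
  calc _ ≤ (∑ l ∈ Finset.range N, ‖c (l + 1)‖ *
            ‖exponentialSum f D (x + (l + 1 : ℕ) * θ)‖) ^ 2 := by gcongr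
    _ ≤ _ := Finset.sum_mul_sq_le_sq_mul_sq _ _ _
    _ ≤ _ := by
      refine mul_le_mul_of_nonneg_right ?_ (Finset.sum_nonneg fun _ _ => by positivity)
      have := sq_nonneg ‖c 0‖
      linarith

/-- From every `s < d` one of the two directions leaves room for `N` steps of any length `θ ≤ L`. -/
theorem exists_direction {d N L s : ℕ} (hL : 2 * (N * L) ≤ d) (hs : s < d) :
    ∃ (ε : ℤ) (ν : ℕ → ℕ → ℕ), ∀ l < N, Set.InjOn (ν l) (Finset.range L) ∧
      ∀ θ < L, ν l θ < d ∧ (ν l θ : ℤ) = s + (l + 1 : ℕ) * (ε * (θ + 1 : ℕ)) := by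
  have hb : ∀ l < N, ∀ θ < L, (l + 1) * (θ + 1) ≤ N * L := fun l hl θ hθ =>
    Nat.mul_le_mul hl hθ
  by_cases h : 2 * s < d
  · refine ⟨1, fun l θ => s + (l + 1) * (θ + 1), fun l hl => ⟨?_, fun θ hθ => ⟨?_, ?_⟩⟩⟩
    · intro a _ b _ hab
      have : (l + 1) * (a + 1) = (l + 1) * (b + 1) := Nat.add_left_cancel hab
      have := Nat.eq_of_mul_eq_mul_left (Nat.succ_pos l) this
      omega
    · have := hb l hl θ hθ; dsimp only; omega
    · push_cast; ring
  · refine ⟨-1, fun l θ => s - (l + 1) * (θ + 1), fun l hl => ⟨?_, fun θ hθ => ⟨?_, ?_⟩⟩⟩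
    · intro a ha b hb' hab
      have h1 := hb l hl a (by simpa using ha)
      have h2 := hb l hl b (by simpa using hb')
      have : (l + 1) * (a + 1) = (l + 1) * (b + 1) := by dsimp only at hab; omega
      have := Nat.eq_of_mul_eq_mul_left (Nat.succ_pos l) this
      omega
    · dsimp only; omega
    · have := hb l hl θ hθ
      rw [Nat.cast_sub (by omega)]; push_cast; ring

theorem sum_comp_le_sum_range {d L : ℕ} {ν : ℕ → ℕ} (hinj : Set.InjOn ν (Finset.range L))
    (hν : ∀ θ < L, ν θ < d) {F : ℕ → ℝ} (hF : ∀ s, 0 ≤ F s) :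
    ∑ θ ∈ Finset.range L, F (ν θ) ≤ ∑ s ∈ Finset.range d, F s := by
  rw [← Finset.sum_image hinj]
  refine Finset.sum_le_sum_of_subset_of_nonneg ?_ fun _ _ _ => hF _
  intro s hs
  obtain ⟨θ, hθ, rfl⟩ := Finset.mem_image.1 hs
  exact Finset.mem_range.2 (hν θ (Finset.mem_range.1 hθ))

/-- The leverage bound: on the square `{0, …, d - 1}²`, the square of an exponential sum at
`s - t` is at most `poly m` times its average, independently of `d`. -/
theorem norm_exponentialSum_sq_mul_le {m d s t : ℕ} (f D : Fin m → ℝ) (hs : s < d) (ht : t < d) :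
    ‖exponentialSum f D (s - t)‖ ^ 2 * (d : ℝ) ^ 2 ≤ 400 * ((m : ℝ) + 1) ^ 9 *
      ∑ s' ∈ Finset.range d, ∑ t' ∈ Finset.range d, ‖exponentialSum f D (s' - t')‖ ^ 2 := by
  obtain ⟨S, hS⟩ : ∃ S, S = ∑ s' ∈ Finset.range d, ∑ t' ∈ Finset.range d,
    ‖exponentialSum f D (s' - t')‖ ^ 2 := ⟨_, rfl⟩
  rw [← hS]
  obtain ⟨N, hN⟩ : ∃ N : ℕ, N = (m + 1) ^ 3 := ⟨_, rfl⟩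
  have hN1 : 1 ≤ N := hN ▸ Nat.one_le_pow _ _ (by omega)
  have hN1' : (1 : ℝ) ≤ N := by exact_mod_cast hN1
  have hpow : ((m : ℝ) + 1) ^ 9 = (N : ℝ) ^ 3 := by rw [hN]; push_cast; ring
  rw [hpow]
  have hS0 : 0 ≤ S := hS ▸ Finset.sum_nonneg fun _ _ => Finset.sum_nonneg fun _ _ => by positivity
  obtain ⟨g, hg⟩ : ∃ g, g = ‖exponentialSum f D (s - t)‖ ^ 2 := ⟨_, rfl⟩
  rw [← hg]
  have hg0 : 0 ≤ g := hg ▸ by positivity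
  -- the largest step length for which `N` steps stay inside half of the interval
  obtain ⟨L, hLdef⟩ : ∃ L, L = d / (2 * N) := ⟨_, rfl⟩
  by_cases hL0 : L = 0
  · have hd : d < 2 * N := by
      rcases Nat.div_eq_zero_iff.1 (hLdef ▸ hL0) with h | h <;> omega
    have hgS : g ≤ S := by
      rw [hS, hg]
      refine le_trans ?_ (Finset.single_le_sum (fun _ _ =>
        Finset.sum_nonneg fun _ _ => by positivity) (Finset.mem_range.2 hs))
      exact Finset.single_le_sum (f := fun t' : ℕ => ‖exponentialSum f D (s - t')‖ ^ 2)
        (fun _ _ => by positivity) (Finset.mem_range.2 ht)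
    have hd' : (d : ℝ) ≤ 2 * N := by exact_mod_cast hd.le
    calc g * (d : ℝ) ^ 2 ≤ S * (2 * N) ^ 2 := by gcongr
      _ = 4 * (N : ℝ) ^ 2 * S := by ring
      _ ≤ 400 * (N : ℝ) ^ 3 * S := by
        have : (N : ℝ) ^ 2 ≤ (N : ℝ) ^ 3 := pow_le_pow_right₀ hN1' (by norm_num)
        have h0 : (0 : ℝ) ≤ N ^ 3 := by positivity
        refine mul_le_mul_of_nonneg_right ?_ hS0
        linarith
  · have hL : 2 * (N * L) ≤ d := by
      have := Nat.mul_div_le d (2 * N)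
      rw [← hLdef] at this
      linarith
    have hdL : (d : ℝ) ≤ 4 * N * L := by
      have h1 : d < 2 * N * (L + 1) := by
        rw [mul_comm]
        exact Nat.lt_mul_of_div_lt (by rw [← hLdef]; exact Nat.lt_succ_self L) (by omega)
      have h2 : 2 * N * (L + 1) ≤ 4 * N * L := by
        have : 1 ≤ L := Nat.one_le_iff_ne_zero.2 hL0
        nlinarith
      exact_mod_cast (h1.le.trans h2)
    obtain ⟨ε, ν, hν⟩ := exists_direction hL hs
    obtain ⟨ε', ν', hν'⟩ := exists_direction hL ht
    have key : (L : ℝ) ^ 2 * g ≤ 25 * N * S := by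
      calc (L : ℝ) ^ 2 * g = ∑ _θ ∈ Finset.range L, ∑ _θ' ∈ Finset.range L, g := by
            simp; ring
        _ ≤ ∑ θ ∈ Finset.range L, ∑ θ' ∈ Finset.range L, 25 * ∑ l ∈ Finset.range N,
              ‖exponentialSum f D (ν l θ - ν' l θ')‖ ^ 2 := by
            refine Finset.sum_le_sum fun θ hθ => Finset.sum_le_sum fun θ' hθ' => ?_
            rw [hg]
            refine (norm_exponentialSum_sq_le f D (s - t)
              (ε * (θ + 1 : ℕ) - ε' * (θ' + 1 : ℕ))).trans (le_of_eq ?_)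
            rw [← hN]
            congr 1
            refine Finset.sum_congr rfl fun l hl => ?_
            rw [((hν l (Finset.mem_range.1 hl)).2 θ (Finset.mem_range.1 hθ)).2,
              ((hν' l (Finset.mem_range.1 hl)).2 θ' (Finset.mem_range.1 hθ')).2]
            congr 3
            ring
        _ = 25 * ∑ l ∈ Finset.range N, ∑ θ ∈ Finset.range L, ∑ θ' ∈ Finset.range L,
              ‖exponentialSum f D (ν l θ - ν' l θ')‖ ^ 2 := by
            simp only [← Finset.mul_sum]
            congr 1
            rw [Finset.sum_comm]
            rw [Finset.sum_comm]
            simp_rw [Finset.sum_comm (s := Finset.range L) (t := Finset.range N)]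
        _ ≤ 25 * ∑ l ∈ Finset.range N, S := by
            gcongr with l hl
            have hl' := Finset.mem_range.1 hl
            rw [hS]
            refine le_trans (Finset.sum_le_sum fun θ _ =>
              sum_comp_le_sum_range (hν' l hl').1 (fun θ hθ => ((hν' l hl').2 θ hθ).1)
              (F := fun t' => ‖exponentialSum f D (ν l θ - t')‖ ^ 2)
              (fun _ => by positivity)) ?_
            exact sum_comp_le_sum_range (hν l hl').1 (fun θ hθ => ((hν l hl').2 θ hθ).1)
              (F := fun s' => ∑ t' ∈ Finset.range d, ‖exponentialSum f D (s' - t')‖ ^ 2)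
              (fun _ => Finset.sum_nonneg fun _ _ => by positivity)
        _ = 25 * N * S := by simp; ring
    calc g * (d : ℝ) ^ 2 ≤ g * (4 * N * L) ^ 2 := by gcongr
      _ = 16 * (N : ℝ) ^ 2 * ((L : ℝ) ^ 2 * g) := by ring
      _ ≤ 16 * (N : ℝ) ^ 2 * (25 * N * S) := by gcongr
      _ = 400 * (N : ℝ) ^ 3 * S := by ring

/-! ### Reasoning about programs -/

/-- Every run of `p` from the work space `σ` ends in a work space that satisfies `Q`, after at most
`t` units of time. -/
def Program.Ensures {d m : ℕ} (B : Matrix (Fin d) (Fin d) ℝ) (f : Fin m → ℝ) (p : Program)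
    (σ : Memory) (Q : Memory → Prop) (t : ℕ) : Prop :=
  ∀ o ∈ (p.run B f σ).support, Q o.1 ∧ o.2 ≤ t

/-- The expected value of `φ` at the final work space of `p`, started from `σ`. -/
noncomputable def Program.expectation {d m : ℕ} (B : Matrix (Fin d) (Fin d) ℝ) (f : Fin m → ℝ)
    (p : Program) (σ : Memory) (φ : Memory → ENNReal) : ENNReal :=
  ∑' o, p.run B f σ o * φ o.1

/-- `for I_c[0] = 0, …, a - 1 do p`, where `p` may read but not write `I_c[0]`. -/
def Program.forLoop (c : ℕ) (a : IntExpr) (p : Program) : Program :=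
  .seq (.setInt c (.lit 0) (.lit 0))
    (.loop a (.seq p (.setInt c (.lit 0) (.plus (.cell c (.lit 0)) (.lit 1)))))

@[simp] theorem Memory.writeInt_reals (σ : Memory) (k i n : ℕ) :
    (σ.writeInt k i n).reals = σ.reals := rfl

@[simp] theorem Memory.writeReal_ints (σ : Memory) (k i j : ℕ) (x : ℝ) :
    (σ.writeReal k i j x).ints = σ.ints := rfl

theorem Memory.writeInt_ints (σ : Memory) (k i n k' i' : ℕ) :
    (σ.writeInt k i n).ints k' i' = if k' = k ∧ i' = i then n else σ.ints k' i' := by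
  by_cases hk : k' = k
  · subst hk
    by_cases hi : i' = i <;> simp [Memory.writeInt, hi]
  · simp [Memory.writeInt, hk]

theorem Memory.writeReal_reals (σ : Memory) (k i j : ℕ) (x : ℝ) (k' i' j' : ℕ) :
    (σ.writeReal k i j x).reals k' i' j'
      = if k' = k ∧ i' = i ∧ j' = j then x else σ.reals k' i' j' := by
  by_cases hk : k' = k
  · subst hk
    by_cases hi : i' = i
    · subst hi
      by_cases hj : j' = j <;> simp [Memory.writeReal, hj]
    · simp [Memory.writeReal, hi]
  · simp [Memory.writeReal, hk]

theorem Memory.writeReal_reals_of_ne (σ : Memory) {k k' : ℕ} (i j : ℕ) (x : ℝ) (h : k' ≠ k) :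
    (σ.writeReal k i j x).reals k' = σ.reals k' := by
  simp [Memory.writeReal, h]

namespace Program

variable {d m : ℕ} {B : Matrix (Fin d) (Fin d) ℝ} {f : Fin m → ℝ} {p q : Program} {σ : Memory}

theorem Ensures.mono {Q R : Memory → Prop} {s t : ℕ} (h : p.Ensures B f σ Q s)
    (hQ : ∀ σ', Q σ' → R σ') (ht : s ≤ t) : p.Ensures B f σ R t :=
  fun o ho => ⟨hQ _ (h o ho).1, (h o ho).2.trans ht⟩

theorem Ensures.seq {Q R : Memory → Prop} {s t : ℕ} (hp : p.Ensures B f σ R s)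
    (hq : ∀ σ', R σ' → q.Ensures B f σ' Q t) : (Program.seq p q).Ensures B f σ Q (s + t) := by
  intro o ho
  simp only [Program.run, PMF.mem_support_bind_iff, PMF.mem_support_pure_iff] at ho
  obtain ⟨a, ha, b, hb, rfl⟩ := ho
  obtain ⟨ha1, ha2⟩ := hp a ha
  obtain ⟨hb1, hb2⟩ := hq _ ha1 b hb
  exact ⟨hb1, add_le_add ha2 hb2⟩

theorem ensures_setInt {k : ℕ} {i a : IntExpr} {Q : Memory → Prop}
    (h : Q (σ.writeInt k (i.eval d m σ) (a.eval d m σ))) :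
    (Program.setInt k i a).Ensures B f σ Q (i.cost + a.cost + 1) := by
  intro o ho
  simp only [Program.run, PMF.mem_support_pure_iff] at ho
  subst ho
  exact ⟨h, le_rfl⟩

theorem ensures_setReal {k : ℕ} {i j : IntExpr} {x : RealExpr} {Q : Memory → Prop}
    (h : Q (σ.writeReal k (i.eval d m σ) (j.eval d m σ) (x.eval B f σ))) :
    (Program.setReal k i j x).Ensures B f σ Q (i.cost + j.cost + x.cost + 1) := by
  intro o ho
  simp only [Program.run, PMF.mem_support_pure_iff] at ho
  subst ho
  exact ⟨h, le_rfl⟩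

theorem mem_support_uniformBelow {n x : ℕ} (hx : x ∈ (uniformBelow n).support) :
    n = 0 ∨ x < n := by
  unfold uniformBelow at hx
  split_ifs at hx with h
  · exact Or.inl h
  · rw [PMF.mem_support_uniformOfFinset_iff] at hx
    exact Or.inr (Finset.mem_range.1 hx)

theorem ensures_sample {k : ℕ} {i a : IntExpr} {Q : Memory → Prop}
    (h : ∀ x, a.eval d m σ = 0 ∨ x < a.eval d m σ → Q (σ.writeInt k (i.eval d m σ) x)) :
    (Program.sample k i a).Ensures B f σ Q (i.cost + a.cost + 1) := by
  intro o ho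
  simp only [Program.run, PMF.mem_support_bind_iff, PMF.mem_support_pure_iff] at ho
  obtain ⟨x, hx, rfl⟩ := ho
  exact ⟨h x (mem_support_uniformBelow hx), le_rfl⟩

theorem ensures_iterateTimed {body : Memory → PMF (Memory × ℕ)} {Inv : ℕ → Memory → Prop} {t : ℕ}
    (n : ℕ) (k : ℕ) (σ : Memory) (h0 : Inv k σ)
    (hstep : ∀ l, l < k + n → ∀ σ, Inv l σ → ∀ o ∈ (body σ).support, Inv (l + 1) o.1 ∧ o.2 ≤ t) :
    ∀ o ∈ (iterateTimed body n σ).support, Inv (k + n) o.1 ∧ o.2 ≤ n * (t + 1) := by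
  induction n generalizing k σ with
  | zero =>
    intro o ho
    simp only [iterateTimed, PMF.mem_support_pure_iff] at ho
    subst ho
    simpa using h0
  | succ n ih =>
    intro o ho
    simp only [iterateTimed, PMF.mem_support_bind_iff, PMF.mem_support_pure_iff] at ho
    obtain ⟨a, ha, b, hb, rfl⟩ := ho
    obtain ⟨ha1, ha2⟩ := hstep k (by omega) σ h0 a ha
    obtain ⟨hb1, hb2⟩ := ih (k + 1) a.1 ha1 (fun l hl => hstep l (by omega)) b hb
    refine ⟨by rwa [show k + (n + 1) = k + 1 + n by ring], ?_⟩
    dsimp only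
    nlinarith

/-- The rule for loops: an invariant `Inv k` that is indexed by the number of completed rounds. -/
theorem ensures_loop {a : IntExpr} (Inv : ℕ → Memory → Prop) {n t : ℕ} (hn : a.eval d m σ = n)
    (h0 : Inv 0 σ) (hstep : ∀ l < n, ∀ σ, Inv l σ → p.Ensures B f σ (Inv (l + 1)) t) :
    (Program.loop a p).Ensures B f σ (Inv n) (a.cost + 1 + n * (t + 1)) := by
  intro o ho
  simp only [Program.run, PMF.mem_support_bind_iff, PMF.mem_support_pure_iff, hn] at ho
  obtain ⟨b, hb, rfl⟩ := ho
  have := ensures_iterateTimed (Inv := Inv) n 0 σ h0 (fun l hl => hstep l (by omega)) b hb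
  rw [zero_add] at this
  exact ⟨this.1, Nat.add_le_add_left this.2 _⟩

/-- The rule for counted loops. The invariant must not depend on the counter cell, and the body must
preserve it. -/
theorem ensures_forLoop {c : ℕ} {a : IntExpr} (Inv : ℕ → Memory → Prop) {n t : ℕ}
    (hn : a.eval d m (σ.writeInt c 0 0) = n) (h0 : Inv 0 (σ.writeInt c 0 0))
    (hinv : ∀ l σ x, Inv l σ → Inv l (σ.writeInt c 0 x))
    (hstep : ∀ l < n, ∀ σ, Inv l σ → σ.ints c 0 = l →
      p.Ensures B f σ (fun σ' => Inv (l + 1) σ' ∧ σ'.ints c 0 = l) t) :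
    (forLoop c a p).Ensures B f σ (Inv n) (a.cost + 4 + n * (t + 7)) := by
  have hfirst : (Program.setInt c (.lit 0) (.lit 0)).Ensures B f σ
      (fun σ' => σ' = σ.writeInt c 0 0) 3 := ensures_setInt rfl
  refine (hfirst.seq (t := a.cost + 1 + n * (t + 6 + 1)) ?_).mono (fun _ h => h) ?_
  swap
  · rw [show t + 6 + 1 = t + 7 from rfl]; omega
  rintro _ rfl
  refine (ensures_loop (fun l σ' => Inv l σ' ∧ σ'.ints c 0 = l) hn
    ⟨h0, by simp [Memory.writeInt_ints]⟩ ?_).mono (fun _ h => h.1) le_rfl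
  rintro l hl σ' ⟨h1, h2⟩
  refine (hstep l hl σ' h1 h2).seq (t := 6) fun σ'' h => ensures_setInt ⟨hinv _ _ _ h.1, ?_⟩
  simp [Memory.writeInt_ints, IntExpr.eval, h.2]

/-! ### Expected values over the runs of a program -/

theorem _root_.PMF.tsum_bind_mul {α β : Type*} (μ : PMF α) (g : α → PMF β) (φ : β → ENNReal) :
    ∑' b, μ.bind g b * φ b = ∑' a, μ a * ∑' b, g a b * φ b := by
  simp only [PMF.bind_apply, ← ENNReal.tsum_mul_right, ← ENNReal.tsum_mul_left]
  rw [ENNReal.tsum_comm]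
  simp only [mul_assoc]

theorem _root_.PMF.tsum_pure_mul {α : Type*} (a : α) (φ : α → ENNReal) :
    ∑' b, PMF.pure a b * φ b = φ a := by
  rw [tsum_eq_single a]
  · simp
  · intro b hb; simp [PMF.pure_apply, hb]

theorem _root_.PMF.tsum_mul_le_of_mem_support {α : Type*} (μ : PMF α) {φ : α → ENNReal}
    {c : ENNReal} (h : ∀ a ∈ μ.support, φ a ≤ c) : ∑' a, μ a * φ a ≤ c := by
  calc ∑' a, μ a * φ a ≤ ∑' a, μ a * c := by
        refine ENNReal.tsum_le_tsum fun a => ?_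
        by_cases ha : μ a = 0
        · simp [ha]
        · gcongr; exact h a ha
    _ = c := by rw [ENNReal.tsum_mul_right, PMF.tsum_coe, one_mul]

theorem expectation_le_of_ensures {φ : Memory → ENNReal} {c : ENNReal} {t : ℕ}
    (h : p.Ensures B f σ (fun σ' => φ σ' ≤ c) t) : p.expectation B f σ φ ≤ c :=
  PMF.tsum_mul_le_of_mem_support _ fun o ho => (h o ho).1

theorem expectation_seq (φ : Memory → ENNReal) :
    (Program.seq p q).expectation B f σ φ
      = p.expectation B f σ fun σ' => q.expectation B f σ' φ := by
  simp only [expectation, Program.run, PMF.tsum_bind_mul, PMF.tsum_pure_mul]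

theorem expectation_sample {k : ℕ} {i a : IntExpr} (φ : Memory → ENNReal)
    (ha : a.eval d m σ ≠ 0) :
    (Program.sample k i a).expectation B f σ φ = (a.eval d m σ : ENNReal)⁻¹ *
      ∑ x ∈ Finset.range (a.eval d m σ), φ (σ.writeInt k (i.eval d m σ) x) := by
  simp only [expectation, Program.run, PMF.tsum_bind_mul, PMF.tsum_pure_mul, uniformBelow,
    dif_neg ha, PMF.uniformOfFinset_apply, Finset.card_range]
  rw [tsum_eq_sum (s := Finset.range (a.eval d m σ)), Finset.mul_sum]
  · exact Finset.sum_congr rfl fun x hx => by rw [if_pos hx]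
  · intro x hx; rw [if_neg hx, zero_mul]

/-- A potential whose expected value grows by at most `c` in every round grows by at most `n c` in
`n` rounds. -/
theorem expectation_loop_le {a : IntExpr} {n t : ℕ} (hn : a.eval d m σ = n) {Inv : Memory → Prop}
    (h0 : Inv σ) (hinv : ∀ σ, Inv σ → p.Ensures B f σ Inv t) (Φ : ℕ → Memory → ENNReal)
    (c : ENNReal) (hstep : ∀ k σ, Inv σ → p.expectation B f σ (Φ (k + 1)) ≤ Φ k σ + c) :
    (Program.loop a p).expectation B f σ (Φ n) ≤ Φ 0 σ + n * c := by
  have key : ∀ (n k : ℕ) (σ : Memory), Inv σ →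
      ∑' o, iterateTimed (p.run B f) n σ o * Φ (k + n) o.1 ≤ Φ k σ + n * c := by
    intro n
    induction n with
    | zero => intro k σ _; simp [iterateTimed]
    | succ n ih =>
      intro k σ hσ
      simp only [iterateTimed, PMF.tsum_bind_mul, PMF.tsum_pure_mul]
      have hle : ∀ o, p.run B f σ o *
          ∑' b, iterateTimed (p.run B f) n o.1 b * Φ (k + (n + 1)) b.1 ≤
            p.run B f σ o * Φ (k + 1) o.1 + p.run B f σ o * (n * c) := by
        intro o
        by_cases ho : p.run B f σ o = 0
        · simp [ho]
        · rw [← mul_add]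
          gcongr
          have := ih (k + 1) o.1 (hinv σ hσ o ho).1
          rwa [show k + 1 + n = k + (n + 1) by ring] at this
      calc _ ≤ _ := ENNReal.tsum_le_tsum hle
        _ = p.expectation B f σ (Φ (k + 1)) + n * c := by
          rw [ENNReal.tsum_add, ENNReal.tsum_mul_right (a := (n : ENNReal) * c), PMF.tsum_coe,
            one_mul]; rfl
        _ ≤ Φ k σ + c + n * c := by gcongr; exact hstep k σ hσ
        _ = _ := by push_cast; ring
  simp only [expectation, Program.run, PMF.tsum_bind_mul, PMF.tsum_pure_mul, hn]
  simpa using key n 0 σ h0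

/-- Markov's inequality for a two-stage computation: if the expected value of `φ` after `p` is at
most `ε` and `q` meets `Q` whenever it is started where `φ < 1`, then `p; q` meets `Q` with
probability at least `1 - ε`. -/
theorem one_le_toOuterMeasure_add_of_expectation_le {φ : Memory → ENNReal} {ε : ENNReal} {t : ℕ}
    (hp : p.expectation B f σ φ ≤ ε) {Q : Memory → Prop}
    (hq : ∀ o ∈ (p.run B f σ).support, φ o.1 < 1 → q.Ensures B f o.1 Q t) :
    1 ≤ ((Program.seq p q).run B f σ).toOuterMeasure {o | Q o.1} + ε := by
  rw [Program.run, PMF.toOuterMeasure_bind_apply]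
  calc (1 : ENNReal) = ∑' a, p.run B f σ a := (PMF.tsum_coe _).symm
    _ ≤ ∑' a, (p.run B f σ a * (((q.run B f a.1).bind fun o' =>
          PMF.pure (o'.1, a.2 + o'.2)).toOuterMeasure {o | Q o.1}) + p.run B f σ a * φ a.1) := by
        refine ENNReal.tsum_le_tsum fun a => ?_
        by_cases ha : p.run B f σ a = 0
        · simp [ha]
        rw [← mul_add]
        nth_rewrite 1 [← mul_one (p.run B f σ a)]
        gcongr
        rcases lt_or_ge (φ a.1) 1 with h | h
        · refine le_add_right (le_of_eq ?_)
          symm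
          rw [PMF.toOuterMeasure_apply_eq_one_iff]
          intro o ho
          simp only [PMF.mem_support_bind_iff, PMF.mem_support_pure_iff] at ho
          obtain ⟨b, hb, rfl⟩ := ho
          exact (hq a ha h b hb).1
        · exact le_add_left h
    _ ≤ _ := by
        rw [ENNReal.tsum_add]
        gcongr
        exact hp

end Program

/-! ### The program -/

/-- The entry `e^{2πi f_j t}` of the Fourier matrix, extended by `0` to all `t` and `j`. -/
noncomputable def phase (d : ℕ) {m : ℕ} (f : Fin m → ℝ) (t j : ℕ) : ℂ :=
  if h : t < d ∧ j < m then
    Complex.exp (2 * Real.pi * Complex.I * (f ⟨j, h.2⟩ : ℂ) * (t : ℂ)) else 0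

/-- Entry `j` of the row of the regression problem that belongs to the position `ω = (s, t)` of `B`:
for `j < m` it is `e^{2πi f_j (s - t)}`, and for `j = m` it is the target `B_{s, t}`. -/
noncomputable def designRow {d m : ℕ} (B : Matrix (Fin d) (Fin d) ℝ) (f : Fin m → ℝ) (ω : ℕ × ℕ)
    (j : ℕ) : ℂ :=
  if j = m then
    ((if h : ω.1 < d ∧ ω.2 < d then B ⟨ω.1, h.1⟩ ⟨ω.2, h.2⟩ else 0 : ℝ) : ℂ)
  else phase d f ω.1 j * (starRingEnd ℂ) (phase d f ω.2 j)

/-- The contribution of the row at `ω` to the real Gram matrix of the columns. -/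
noncomputable def rowGram {d m : ℕ} (B : Matrix (Fin d) (Fin d) ℝ) (f : Fin m → ℝ) (ω : ℕ × ℕ)
    (i j : ℕ) : ℝ :=
  (designRow B f ω i).re * (designRow B f ω j).re + (designRow B f ω i).im * (designRow B f ω j).im

/-- The real Gram matrix of the `m + 1` columns of the regression problem, restricted to the rows in
the list `ℓ`. -/
noncomputable def sampledGram {d m : ℕ} (B : Matrix (Fin d) (Fin d) ℝ) (f : Fin m → ℝ)
    (ℓ : List (ℕ × ℕ)) (i j : ℕ) : ℝ :=
  (ℓ.map fun ω => rowGram B f ω i j).sum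

/-- The tableau after `k` steps of Gaussian elimination without pivoting. A vanishing pivot leaves
the rows below it unchanged, by the convention `x / 0 = 0`. -/
noncomputable def eliminate (T : ℕ → ℕ → ℝ) : ℕ → ℕ → ℕ → ℝ
  | 0 => T
  | k + 1 => fun i j => if k < i then
      eliminate T k i j - eliminate T k i k / eliminate T k k k * eliminate T k k j
    else eliminate T k i j

/-- The tableau `[G | 1]`, whose right half starts at column `m + 1`. -/
noncomputable def augment (m : ℕ) (G : ℕ → ℕ → ℝ) (i j : ℕ) : ℝ :=
  if j < m + 1 then G i j else if j = m + 1 + i then 1 else 0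

namespace RegressionProgram

open Program

/-- The integer variable number `k`. -/
def var (k : ℕ) : IntExpr := .cell k (.lit 0)

/-- `I_0[0] := I_0[0] * (m + 1)` -/
def timesSuccCard : Program :=
  .seq (.setInt 1 (.lit 0) (.lit 0))
    (.seq (.loop (.plus .card (.lit 1)) (.setInt 1 (.lit 0) (.plus (var 1) (var 0))))
      (.setInt 0 (.lit 0) (var 1)))

/-- `I_0[0] := c * (m + 1) ^ e` -/
def setScaledPower (c : ℕ) : ℕ → Program
  | 0 => .setInt 0 (.lit 0) (.lit c)
  | e + 1 => .seq (setScaledPower c e) timesSuccCard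

/-- Stores the row at the position `(I_2[0], I_3[0])`: real parts in `R_2[0, ·]`, imaginary parts in
`R_2[1, ·]`. -/
def loadRow : Program :=
  .seq (forLoop 5 .card (.seq
      (.setReal 2 (.lit 0) (var 5)
        (.plus (.times (.cosine (var 2) (var 5)) (.cosine (var 3) (var 5)))
          (.times (.sine (var 2) (var 5)) (.sine (var 3) (var 5)))))
      (.setReal 2 (.lit 1) (var 5)
        (.minus (.times (.sine (var 2) (var 5)) (.cosine (var 3) (var 5)))
          (.times (.cosine (var 2) (var 5)) (.sine (var 3) (var 5)))))))
    (.seq (.setReal 2 (.lit 0) .card (.entry (var 2) (var 3)))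
      (.setReal 2 (.lit 1) .card (.ofInt (.lit 0))))

/-- Adds the Gram matrix of the stored row to `R_1`. -/
def addRowGram : Program :=
  forLoop 4 (.plus .card (.lit 1)) (forLoop 5 (.plus .card (.lit 1))
    (.setReal 1 (var 4) (var 5) (.plus (.cell 1 (var 4) (var 5))
      (.plus (.times (.cell 2 (.lit 0) (var 4)) (.cell 2 (.lit 0) (var 5)))
        (.times (.cell 2 (.lit 1) (var 4)) (.cell 2 (.lit 1) (var 5)))))))

/-- Draws a uniform position and adds the Gram matrix of its row to `R_1`. -/
def sampleRow : Program :=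
  .seq (.sample 2 (.lit 0) .dim) (.seq (.sample 3 (.lit 0) .dim) (.seq loadRow addRowGram))

/-- Writes the identity matrix to the right of the Gram matrix in `R_1`. -/
def appendIdentity : Program :=
  forLoop 4 (.plus .card (.lit 1))
    (.setReal 1 (var 4) (.plus (.plus .card (.lit 1)) (var 4)) (.ofInt (.lit 1)))

/-- Subtracts multiples of row `I_6[0]` of `R_1` from the rows below it. -/
def eliminateBelow : Program :=
  forLoop 4 (.minus .card (var 6)) (.seq
    (.setReal 3 (.lit 0) (.lit 0) (.quot (.cell 1 (.plus (.plus (var 6) (.lit 1)) (var 4)) (var 6))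
      (.cell 1 (var 6) (var 6))))
    (forLoop 5 (.plus (.plus .card .card) (.lit 2))
      (.setReal 1 (.plus (.plus (var 6) (.lit 1)) (var 4)) (var 5)
        (.minus (.cell 1 (.plus (.plus (var 6) (.lit 1)) (var 4)) (var 5))
          (.times (.cell 3 (.lit 0) (.lit 0)) (.cell 1 (var 6) (var 5)))))))

/-- Writes the negated last row of the right half of `R_1` to the output. -/
def output : Program :=
  forLoop 5 .card (.setReal 0 (var 5) (.lit 0)
    (.minus (.ofInt (.lit 0)) (.cell 1 .card (.plus (.plus .card (.lit 1)) (var 5)))))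

/-- Collects the Gram matrix of `128000000 * (m + 1) ^ 20` random rows. -/
def sampling : Program :=
  .seq (setScaledPower 128000000 20) (.loop (var 0) sampleRow)

/-- Solves the sampled regression problem. -/
def solve : Program :=
  .seq appendIdentity (.seq (forLoop 6 .card eliminateBelow) output)

section
variable {d m : ℕ} {B : Matrix (Fin d) (Fin d) ℝ} {f : Fin m → ℝ}

@[simp] theorem var_cost (k : ℕ) : (var k).cost = 2 := rfl

@[simp] theorem var_eval (σ : Memory) (k : ℕ) : (var k).eval d m σ = σ.ints k 0 := rfl

theorem ensures_timesSuccCard {σ : Memory} {n : ℕ} (hn : σ.ints 0 0 = n) :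
    timesSuccCard.Ensures B f σ (fun σ' => σ'.ints 0 0 = n * (m + 1) ∧ σ'.reals = σ.reals)
      (3 + (4 + (m + 1) * 8 + 4)) := by
  refine (ensures_setInt (Q := fun σ' => σ'.ints 0 0 = n ∧ σ'.ints 1 0 = 0 ∧ σ'.reals = σ.reals)
    ?_).seq fun σ₁ h₁ => ?_
  · simp [Memory.writeInt_ints, IntExpr.eval, hn]
  refine (ensures_loop (t := 7) (fun l σ' => σ'.ints 0 0 = n ∧ σ'.ints 1 0 = n * l ∧
    σ'.reals = σ.reals) (n := m + 1) rfl (by simpa using h₁) ?_).seq fun σ₂ h₂ => ?_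
  · rintro l - σ' ⟨h1, h2, h3⟩
    refine ensures_setInt ?_
    simp [Memory.writeInt_ints, IntExpr.eval, h1, h2, h3]
    ring
  · refine ensures_setInt ?_
    simp [Memory.writeInt_ints, IntExpr.eval, h₂]

theorem ensures_setScaledPower (c e : ℕ) {σ : Memory} :
    (setScaledPower c e).Ensures B f σ
      (fun σ' => σ'.ints 0 0 = c * (m + 1) ^ e ∧ σ'.reals = σ.reals)
      (3 + e * (3 + (4 + (m + 1) * 8 + 4))) := by
  induction e with
  | zero =>
    refine (ensures_setInt ?_).mono (fun _ h => h) (by simp [IntExpr.cost])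
    simp [Memory.writeInt_ints, IntExpr.eval]
  | succ e ih =>
    refine (ih.seq fun σ' h => (ensures_timesSuccCard h.1).mono
      (R := fun σ' => σ'.ints 0 0 = c * (m + 1) ^ (e + 1) ∧ σ'.reals = σ.reals)
      (fun σ'' h' => ⟨?_, ?_⟩) le_rfl).mono (fun _ h => h) ?_
    · rw [h'.1]; ring
    · rw [h'.2, h.2]
    · apply le_of_eq; ring

theorem exp_two_pi_mul_I (x : ℝ) (t : ℕ) :
    Complex.exp (2 * Real.pi * Complex.I * (x : ℂ) * (t : ℂ))
      = Complex.exp ((2 * Real.pi * x * t : ℝ) * Complex.I) := by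
  congr 1; push_cast; ring

theorem cosine_eval (σ : Memory) (t j : IntExpr) :
    (RealExpr.cosine t j).eval B f σ = (phase d f (t.eval d m σ) (j.eval d m σ)).re := by
  rw [RealExpr.eval, phase]
  split_ifs with h
  · rw [exp_two_pi_mul_I, Complex.exp_ofReal_mul_I_re]
  · simp

theorem sine_eval (σ : Memory) (t j : IntExpr) :
    (RealExpr.sine t j).eval B f σ = (phase d f (t.eval d m σ) (j.eval d m σ)).im := by
  rw [RealExpr.eval, phase]
  split_ifs with h
  · rw [exp_two_pi_mul_I, Complex.exp_ofReal_mul_I_im]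
  · simp

theorem designRow_eq_zero {ω : ℕ × ℕ} {j : ℕ} (hj : m < j) : designRow B f ω j = 0 := by
  have h1 : ¬ j < m := by omega
  simp [designRow, phase, hj.ne', h1]

theorem ensures_loadRow {σ : Memory} {s t : ℕ} (hs : σ.ints 2 0 = s) (ht : σ.ints 3 0 = t) :
    loadRow.Ensures B f σ (fun σ' => σ'.reals 1 = σ.reals 1 ∧
      ∀ j < m + 1, σ'.reals 2 0 j = (designRow B f (s, t) j).re ∧
        σ'.reals 2 1 j = (designRow B f (s, t) j).im) (5 + m * 61 + 13) := by
  refine (ensures_forLoop (n := m) (t := 54) (fun l σ' => σ'.reals 1 = σ.reals 1 ∧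
    σ'.ints 2 0 = s ∧ σ'.ints 3 0 = t ∧ ∀ j < l, σ'.reals 2 0 j = (designRow B f (s, t) j).re ∧
      σ'.reals 2 1 j = (designRow B f (s, t) j).im) rfl ?_ ?_ ?_).seq (t := 13) fun σ₁ h₁ => ?_
  · simp [Memory.writeInt_ints, hs, ht]
  · intro l σ' x h
    simpa [Memory.writeInt_ints] using h
  · rintro l hl σ' ⟨h1, h2, h3, h4⟩ h5
    refine (ensures_setReal (Q := fun σ'' => σ''.ints = σ'.ints ∧ σ''.reals 1 = σ.reals 1 ∧
      (∀ j < l + 1, σ''.reals 2 0 j = (designRow B f (s, t) j).re) ∧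
      ∀ j < l, σ''.reals 2 1 j = (designRow B f (s, t) j).im) ?_).seq (t := 27)
        fun σ'' h'' => ensures_setReal ?_
    · refine ⟨rfl, ?_, fun j hj => ?_, fun j hj => ?_⟩
      · rw [Memory.writeReal_reals_of_ne _ _ _ _ (by decide), h1]
      · rw [Memory.writeReal_reals]
        simp only [IntExpr.eval, var_eval, h5, true_and]
        split_ifs with hjl
        · subst hjl
          simp [RealExpr.eval.eq_7, RealExpr.eval.eq_9, cosine_eval, sine_eval, h2, h3, h5,
            designRow, hl.ne]
        · exact (h4 j (by omega)).1
      · rw [Memory.writeReal_reals]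
        simpa [IntExpr.eval] using (h4 j hj).2
    · obtain ⟨k1, k2, k3, k4⟩ := h''
      refine ⟨⟨?_, ?_, ?_, fun j hj => ⟨?_, ?_⟩⟩, ?_⟩
      · rw [Memory.writeReal_reals_of_ne _ _ _ _ (by decide), k2]
      · simp [k1, h2]
      · simp [k1, h3]
      · rw [Memory.writeReal_reals]
        simpa [IntExpr.eval] using k3 j hj
      · rw [Memory.writeReal_reals]
        simp only [IntExpr.eval, var_eval, k1, h5, true_and]
        split_ifs with hjl
        · subst hjl
          simp [RealExpr.eval.eq_8, RealExpr.eval.eq_9, cosine_eval, sine_eval, k1, h2, h3, h5,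
            designRow, hl.ne]
          ring
        · exact k4 j (by omega)
      · simp [k1, h5]
  · obtain ⟨h1, h2, h3, h4⟩ := h₁
    refine (ensures_setReal (Q := fun σ'' => σ''.reals 1 = σ.reals 1 ∧
      (∀ j < m + 1, σ''.reals 2 0 j = (designRow B f (s, t) j).re) ∧
      ∀ j < m, σ''.reals 2 1 j = (designRow B f (s, t) j).im) ?_).seq (t := 5)
        fun σ'' h'' => ensures_setReal ?_
    · refine ⟨?_, fun j hj => ?_, fun j hj => ?_⟩
      · rw [Memory.writeReal_reals_of_ne _ _ _ _ (by decide), h1]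
      · rw [Memory.writeReal_reals]
        simp only [IntExpr.eval, true_and]
        split_ifs with hjl
        · subst hjl
          simp [RealExpr.eval, h2, h3, designRow]
        · exact (h4 j (by omega)).1
      · rw [Memory.writeReal_reals]
        simpa [IntExpr.eval] using (h4 j hj).2
    · obtain ⟨k2, k3, k4⟩ := h''
      refine ⟨?_, fun j hj => ⟨?_, ?_⟩⟩
      · rw [Memory.writeReal_reals_of_ne _ _ _ _ (by decide), k2]
      · rw [Memory.writeReal_reals]
        simpa [IntExpr.eval] using k3 j hj
      · rw [Memory.writeReal_reals]
        simp only [IntExpr.eval, true_and]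
        split_ifs with hjl
        · subst hjl
          simp [RealExpr.eval, IntExpr.eval, designRow]
        · exact k4 j (by omega)

theorem ensures_addRowGram {σ : Memory} {ω : ℕ × ℕ}
    (hrow : ∀ j < m + 1, σ.reals 2 0 j = (designRow B f ω j).re ∧
      σ.reals 2 1 j = (designRow B f ω j).im) :
    addRowGram.Ensures B f σ (fun σ' => σ'.reals 1 = fun i j => σ.reals 1 i j + rowGram B f ω i j)
      (7 + (m + 1) * (7 + (m + 1) * 37 + 7)) := by
  have hzero : ∀ i j, m < i ∨ m < j → rowGram B f ω i j = 0 := by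
    rintro i j (h | h) <;> simp [rowGram, designRow_eq_zero h]
  refine (ensures_forLoop (n := m + 1) (t := 7 + (m + 1) * 37) (fun l σ' =>
    σ'.reals 2 = σ.reals 2 ∧ ∀ i j, σ'.reals 1 i j = σ.reals 1 i j +
      if i < l then rowGram B f ω i j else 0) rfl ?_ ?_ ?_).mono ?_ le_rfl
  · simp
  · intro l σ' x h
    simpa using h
  · rintro l hl σ' ⟨h1, h2⟩ h3
    refine (ensures_forLoop (n := m + 1) (t := 30) (fun l' σ'' =>
      σ''.ints 4 0 = l ∧ σ''.reals 2 = σ.reals 2 ∧ ∀ i j, σ''.reals 1 i j = σ.reals 1 i j +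
        if i < l ∨ (i = l ∧ j < l') then rowGram B f ω i j else 0) rfl ?_ ?_ ?_).mono ?_ le_rfl
    · simpa [Memory.writeInt_ints, h3, h1] using h2
    · intro l σ' x h
      simpa [Memory.writeInt_ints] using h
    · rintro l' hl' σ'' ⟨k1, k2, k3⟩ k4
      refine ensures_setReal ⟨⟨?_, ?_, fun i j => ?_⟩, ?_⟩
      · simpa using k1
      · rw [Memory.writeReal_reals_of_ne _ _ _ _ (by decide), k2]
      · rw [Memory.writeReal_reals]
        simp only [var_eval, k1, k4, true_and, RealExpr.eval, k2, IntExpr.eval,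
          (hrow l hl).1, (hrow l hl).2, (hrow l' hl').1, (hrow l' hl').2]
        split_ifs with c1 c2 c2
        · obtain ⟨rfl, rfl⟩ := c1
          rw [k3]
          simp [rowGram]
        · omega
        · rw [k3, if_pos (by omega)]
        · rw [k3, if_neg (by omega)]
      · simpa using k4
    · rintro σ'' ⟨k1, k2, k3⟩
      refine ⟨⟨k2, fun i j => ?_⟩, k1⟩
      rw [k3]
      congr 1
      by_cases hj : m < j
      · simp [hzero i j (Or.inr hj)]
      · have : (i < l ∨ i = l ∧ j < m + 1) ↔ i < l + 1 := by omega
        simp only [this]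
  · rintro σ' ⟨-, h⟩
    funext i j
    rw [h]
    congr 1
    by_cases hi : m < i
    · simp [hzero i j (Or.inl hi)]
    · rw [if_pos (by omega)]

/-- A bound for the time of storing a row and adding its Gram matrix. -/
def rowTime (m : ℕ) : ℕ := 5 + m * 61 + 13 + (7 + (m + 1) * (7 + (m + 1) * 37 + 7))

theorem ensures_accumulate {σ : Memory} {ω : ℕ × ℕ} (hs : σ.ints 2 0 = ω.1)
    (ht : σ.ints 3 0 = ω.2) :
    (Program.seq loadRow addRowGram).Ensures B f σ
      (fun σ' => σ'.reals 1 = fun i j => σ.reals 1 i j + rowGram B f ω i j) (rowTime m) := by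
  refine (ensures_loadRow hs ht).seq fun σ₁ h₁ => ?_
  have := ensures_addRowGram (σ := σ₁) (ω := ω) h₁.2
  rwa [h₁.1] at this

end
end RegressionProgram

/-! ### Correctness of the program -/

namespace RegressionProgram

open Program

section
variable {d m : ℕ} {B : Matrix (Fin d) (Fin d) ℝ} {f : Fin m → ℝ}

theorem sampledGram_cons (ω : ℕ × ℕ) (ℓ : List (ℕ × ℕ)) :
    sampledGram B f (ω :: ℓ) = fun i j => sampledGram B f ℓ i j + rowGram B f ω i j := by
  funext i j
  simp [sampledGram, add_comm]

theorem ensures_sampleRow {σ : Memory} (h : ∃ ℓ, σ.reals 1 = sampledGram B f ℓ) :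
    sampleRow.Ensures B f σ (fun σ' => ∃ ℓ, σ'.reals 1 = sampledGram B f ℓ)
      (3 + (3 + rowTime m)) := by
  obtain ⟨ℓ, hℓ⟩ := h
  refine (ensures_sample (Q := fun σ' => σ'.reals 1 = sampledGram B f ℓ) fun x _ => hℓ).seq
    fun σ₁ h₁ => ?_
  refine (ensures_sample (Q := fun σ' => σ'.reals 1 = sampledGram B f ℓ) fun x _ => h₁).seq
    fun σ₂ h₂ => ?_
  refine (ensures_accumulate (ω := (σ₂.ints 2 0, σ₂.ints 3 0)) rfl rfl).mono (fun σ' h' =>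
    ⟨(σ₂.ints 2 0, σ₂.ints 3 0) :: ℓ, ?_⟩) le_rfl
  rw [h', h₂, sampledGram_cons]

theorem expectation_sampleRow_le {σ : Memory} (hd : d ≠ 0) (Φ : (ℕ → ℕ → ℝ) → ENNReal) :
    sampleRow.expectation B f σ (fun σ' => Φ (σ'.reals 1)) ≤
      (d : ENNReal)⁻¹ * ∑ s ∈ Finset.range d, (d : ENNReal)⁻¹ * ∑ t ∈ Finset.range d,
        Φ (fun i j => σ.reals 1 i j + rowGram B f (s, t) i j) := by
  rw [sampleRow, expectation_seq, expectation_sample (a := .dim) _ hd]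
  dsimp only [IntExpr.eval]
  gcongr with s hs
  rw [expectation_seq, expectation_sample (a := .dim) _ hd]
  dsimp only [IntExpr.eval]
  gcongr with t ht
  refine expectation_le_of_ensures ((ensures_accumulate (ω := (s, t)) ?_ ?_).mono
    (fun σ' h' => ?_) le_rfl)
  · simp [Memory.writeInt_ints]
  · simp [Memory.writeInt_ints]
  · rw [h']; simp

theorem ensures_sampling :
    sampling.Ensures B f Memory.init (fun σ => ∃ ℓ, σ.reals 1 = sampledGram B f ℓ)
      (3 + 20 * (3 + (4 + (m + 1) * 8 + 4)) +
        (3 + 128000000 * (m + 1) ^ 20 * (3 + (3 + rowTime m) + 1))) := by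
  refine (ensures_setScaledPower 128000000 20).seq fun σ h => ?_
  refine ensures_loop (fun _ σ => ∃ ℓ, σ.reals 1 = sampledGram B f ℓ) h.1 ⟨[], ?_⟩
    fun l _ σ hσ => ensures_sampleRow hσ
  rw [h.2]
  funext i j
  simp [Memory.init, sampledGram]

/-- A real potential of the sampled Gram matrix whose average over a fresh row grows by at most `a`
has expected value at most `F 0 0 + n a` after `n` rounds. -/
theorem expectation_sampling_le (hd : d ≠ 0) (F : ℕ → (ℕ → ℕ → ℝ) → ℝ) {a : ℝ} (ha : 0 ≤ a)
    (hF : ∀ k ℓ, 0 ≤ F k (sampledGram B f ℓ))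
    (hstep : ∀ k ℓ, ∑ s ∈ Finset.range d, ∑ t ∈ Finset.range d,
      F (k + 1) (sampledGram B f ((s, t) :: ℓ)) ≤ (d : ℝ) ^ 2 * (F k (sampledGram B f ℓ) + a)) :
    sampling.expectation B f Memory.init
        (fun σ => ENNReal.ofReal (F (128000000 * (m + 1) ^ 20) (σ.reals 1))) ≤
      ENNReal.ofReal (F 0 (fun _ _ => 0) + (128000000 * (m + 1) ^ 20 : ℕ) * a) := by
  have hd' : (0 : ℝ) < d := by exact_mod_cast Nat.pos_of_ne_zero hd
  have hinit : (fun _ _ => 0 : ℕ → ℕ → ℝ) = sampledGram B f [] := by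
    funext i j; simp [sampledGram]
  generalize hn : 128000000 * (m + 1) ^ 20 = n
  rw [sampling, expectation_seq]
  refine expectation_le_of_ensures ((ensures_setScaledPower 128000000 20).mono (fun σ h => ?_)
    le_rfl)
  rw [ENNReal.ofReal_add (hinit ▸ hF 0 []) (by positivity), ENNReal.ofReal_mul (by positivity),
    ENNReal.ofReal_natCast]
  have hσ : σ.reals 1 = fun _ _ => 0 := by rw [h.2]; rfl
  refine (expectation_loop_le (n := n) (by rw [← hn]; exact h.1)
    (Inv := fun σ => ∃ ℓ, σ.reals 1 = sampledGram B f ℓ) ⟨[], by rw [hσ, hinit]⟩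
    (fun σ hσ => ensures_sampleRow hσ) (fun k σ => ENNReal.ofReal (F k (σ.reals 1)))
    (ENNReal.ofReal a) ?_).trans (by rw [hσ])
  rintro k σ ⟨ℓ, hℓ⟩
  refine (expectation_sampleRow_le hd fun G => ENNReal.ofReal (F (k + 1) G)).trans ?_
  have hinv : (d : ENNReal)⁻¹ = ENNReal.ofReal ((d : ℝ)⁻¹) := by
    rw [ENNReal.ofReal_inv_of_pos hd', ENNReal.ofReal_natCast]
  have hpos : ∀ s t, 0 ≤ F (k + 1) (sampledGram B f ((s, t) :: ℓ)) := fun s t => hF _ _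
  simp only [hℓ, ← sampledGram_cons]
  rw [hinv, ← ENNReal.ofReal_add (hF _ _) ha]
  have h1 : ∀ s ∈ Finset.range d, ENNReal.ofReal ((d : ℝ)⁻¹) * ∑ t ∈ Finset.range d,
      ENNReal.ofReal (F (k + 1) (sampledGram B f ((s, t) :: ℓ))) =
      ENNReal.ofReal ((d : ℝ)⁻¹ * ∑ t ∈ Finset.range d,
        F (k + 1) (sampledGram B f ((s, t) :: ℓ))) := fun s _ => by
    rw [ENNReal.ofReal_mul (by positivity), ENNReal.ofReal_sum_of_nonneg fun t _ => hpos s t]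
  rw [Finset.sum_congr rfl h1, ← ENNReal.ofReal_sum_of_nonneg fun s _ =>
    mul_nonneg (by positivity) (Finset.sum_nonneg fun t _ => hpos s t),
    ← ENNReal.ofReal_mul (by positivity), ← Finset.mul_sum]
  apply ENNReal.ofReal_le_ofReal
  have h2 := hstep k ℓ
  clear hn hσ
  generalize F k (sampledGram B f ℓ) + a = X at h2 ⊢
  generalize ∑ s ∈ Finset.range d, ∑ t ∈ Finset.range d,
    F (k + 1) (sampledGram B f ((s, t) :: ℓ)) = S at h2 ⊢
  rw [← mul_assoc, ← mul_inv, ← sq, inv_mul_le_iff₀ (by positivity)]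
  exact h2

theorem ensures_appendIdentity {σ : Memory} {G : ℕ → ℕ → ℝ} (hG : σ.reals 1 = G)
    (hzero : ∀ i j, m < j → G i j = 0) :
    appendIdentity.Ensures B f σ
      (fun σ' => ∀ i < m + 1, ∀ j < 2 * m + 2, σ'.reals 1 i j = augment m G i j)
      (7 + (m + 1) * 18) := by
  refine (ensures_forLoop (n := m + 1) (t := 11) (fun l σ' => ∀ i j, σ'.reals 1 i j =
    if i < l ∧ j = m + 1 + i then 1 else G i j) rfl ?_ ?_ ?_).mono ?_ le_rfl
  · simp [hG]
  · intro l σ' x h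
    simpa using h
  · intro l hl σ' h h'
    refine ensures_setReal ⟨fun i j => ?_, ?_⟩
    · rw [Memory.writeReal_reals]
      simp only [IntExpr.eval, var_eval, h', true_and, RealExpr.eval, Nat.cast_one, h]
      split_ifs <;> first | rfl | omega
    · simpa using h'
  · intro σ' h i hi j hj
    rw [h, augment]
    split_ifs <;> first | rfl | omega | exact hzero _ _ (by omega)

theorem eliminate_succ_of_lt (T : ℕ → ℕ → ℝ) {k i : ℕ} (h : k < i) (j : ℕ) :
    eliminate T (k + 1) i j =
      eliminate T k i j - eliminate T k i k / eliminate T k k k * eliminate T k k j :=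
  if_pos h

theorem eliminate_succ_of_le (T : ℕ → ℕ → ℝ) {k i : ℕ} (h : i ≤ k) (j : ℕ) :
    eliminate T (k + 1) i j = eliminate T k i j :=
  if_neg (not_lt.2 h)

/-- One round of the outer loop performs one step of `eliminate`. The row of the pivot is not changed
in the process, so that the in-place updates agree with the simultaneous ones. -/
theorem ensures_eliminateBelow {σ : Memory} {T : ℕ → ℕ → ℝ} {k : ℕ} (hk : k < m)
    (hσ : σ.ints 6 0 = k)
    (hT : ∀ i < m + 1, ∀ j < 2 * m + 2, σ.reals 1 i j = eliminate T k i j) :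
    eliminateBelow.Ensures B f σ (fun σ' => σ'.ints 6 0 = k ∧
      ∀ i < m + 1, ∀ j < 2 * m + 2, σ'.reals 1 i j = eliminate T (k + 1) i j)
      (8 + m * (19 + (9 + (2 * m + 2) * 37) + 7)) := by
  refine (ensures_forLoop (n := m - k) (t := 19 + (9 + (2 * m + 2) * 37)) (fun l σ' =>
    σ'.ints 6 0 = k ∧ ∀ i < m + 1, ∀ j < 2 * m + 2, σ'.reals 1 i j =
      if i < k + 1 + l then eliminate T (k + 1) i j else eliminate T k i j) ?_ ?_ ?_ ?_).mono
        ?_ ?_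
  · simp [IntExpr.eval, Memory.writeInt_ints, hσ]
  · refine ⟨by simpa [Memory.writeInt_ints] using hσ, fun i hi j hj => ?_⟩
    rw [Memory.writeInt_reals, hT i hi j hj]
    split_ifs with h
    · rw [eliminate_succ_of_le T (by omega)]
    · rfl
  · intro l σ' x h
    simpa [Memory.writeInt_ints] using h
  · rintro l hl σ' ⟨h1, h2⟩ h3
    have hr : k + 1 + l < m + 1 := by omega
    refine (ensures_setReal (Q := fun σ'' => σ''.ints 6 0 = k ∧ σ''.ints 4 0 = l ∧
      σ''.reals 3 0 0 = eliminate T k (k + 1 + l) k / eliminate T k k k ∧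
      σ''.reals 1 = σ'.reals 1) ?_).seq fun σ₁ h₁ => ?_
    · refine ⟨by simpa using h1, by simpa using h3, ?_, ?_⟩
      · rw [Memory.writeReal_reals]
        simp only [IntExpr.eval, RealExpr.eval, var_eval, h1, h3, and_self, if_true]
        rw [h2 _ hr _ (by omega), h2 _ (by omega) _ (by omega), if_neg (by omega),
          if_pos (by omega), eliminate_succ_of_le T le_rfl]
      · rw [Memory.writeReal_reals_of_ne _ _ _ _ (by decide)]
    obtain ⟨h4, h5, h6, h7⟩ := h₁
    refine (ensures_forLoop (n := 2 * m + 2) (t := 30) (fun l' σ'' => σ''.ints 6 0 = k ∧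
      σ''.ints 4 0 = l ∧ σ''.reals 3 = σ₁.reals 3 ∧ ∀ i < m + 1, ∀ j < 2 * m + 2,
        σ''.reals 1 i j = if i < k + 1 + l ∨ (i = k + 1 + l ∧ j < l')
          then eliminate T (k + 1) i j else eliminate T k i j) ?_ ?_ ?_ ?_).mono ?_ ?_
    · simp [IntExpr.eval]; omega
    · refine ⟨by simpa [Memory.writeInt_ints] using h4, by simpa [Memory.writeInt_ints] using h5,
        rfl, fun i hi j hj => ?_⟩
      rw [Memory.writeInt_reals, h7, h2 i hi j hj]
      simp
    · intro l' σ'' x h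
      simpa [Memory.writeInt_ints] using h
    · rintro l' hl' σ'' ⟨k1, k2, k3, k4⟩ k5
      refine ensures_setReal ⟨⟨by simpa using k1, by simpa using k2, ?_, fun i hi j hj => ?_⟩,
        by simpa using k5⟩
      · rw [Memory.writeReal_reals_of_ne _ _ _ _ (by decide), k3]
      · rw [Memory.writeReal_reals]
        simp only [IntExpr.eval, RealExpr.eval, var_eval, k1, k2, k3, k5, h6, true_and]
        split_ifs with c1 c2 c2
        · obtain ⟨rfl, rfl⟩ := c1
          rw [k4 _ hr _ hl', k4 k (by omega) _ hl', if_neg (by omega), if_pos (by omega),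
            eliminate_succ_of_le T (le_refl k), eliminate_succ_of_lt T (i := k + 1 + l) (by omega)]
        · omega
        · rw [k4 i hi j hj, if_pos (by omega)]
        · rw [k4 i hi j hj, if_neg (by omega)]
    · rintro σ'' ⟨k1, k2, k3, k4⟩
      refine ⟨⟨k1, fun i hi j hj => ?_⟩, k2⟩
      rw [k4 i hi j hj]
      have : (i < k + 1 + l ∨ i = k + 1 + l ∧ j < 2 * m + 2) ↔ i < k + 1 + (l + 1) := by omega
      simp only [this]
    · simp [IntExpr.cost]
  · rintro σ' ⟨h1, h2⟩
    refine ⟨h1, fun i hi j hj => ?_⟩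
    rw [h2 i hi j hj, if_pos (by omega)]
  · gcongr
    · simp [IntExpr.cost]
    · omega

/-- A bound for the running time of `solve`. -/
def solveTime (m : ℕ) : ℕ :=
  7 + (m + 1) * 18 + ((5 + m * (8 + m * (19 + (9 + (2 * m + 2) * 37) + 7) + 7)) + (5 + m * 22))

theorem ensures_solve {σ : Memory} {G : ℕ → ℕ → ℝ} (hG : σ.reals 1 = G)
    (hzero : ∀ i j, m < j → G i j = 0) :
    solve.Ensures B f σ
      (fun σ' => ∀ j < m, σ'.reals 0 j 0 = - eliminate (augment m G) m m (m + 1 + j))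
      (solveTime m) := by
  refine (ensures_appendIdentity hG hzero).seq fun σ₁ h₁ => ?_
  refine (ensures_forLoop (n := m) (fun k σ' => ∀ i < m + 1, ∀ j < 2 * m + 2,
    σ'.reals 1 i j = eliminate (augment m G) k i j) rfl
    (by rwa [Memory.writeInt_reals]) ?_ ?_).seq
      fun σ₂ h₂ => ?_
  · intro l σ' x h
    simpa using h
  · intro k hk σ' h h'
    exact (ensures_eliminateBelow hk h' h).mono (fun _ h => h.symm) le_rfl
  refine (ensures_forLoop (n := m) (t := 15) (fun l σ' => σ'.reals 1 = σ₂.reals 1 ∧ ∀ j < l,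
    σ'.reals 0 j 0 = - eliminate (augment m G) m m (m + 1 + j)) rfl ?_ ?_ ?_).mono
      (fun _ h => h.2) le_rfl
  · simp
  · intro l σ' x h
    simpa using h
  · rintro l hl σ' ⟨h1, h2⟩ h3
    refine ensures_setReal ⟨⟨?_, fun j hj => ?_⟩, by simpa using h3⟩
    · rw [Memory.writeReal_reals_of_ne _ _ _ _ (by decide), h1]
    · rw [Memory.writeReal_reals]
      simp only [IntExpr.eval, RealExpr.eval, var_eval, h3, true_and, and_true]
      split_ifs with c
      · subst c
        rw [h1, h₂ m (by omega) _ (by omega)]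
        simp
      · exact h2 j (by omega)

end
end RegressionProgram

/-! ### Gaussian elimination on a Gram matrix -/

/-- The bilinear form `∑ i j, u_i v_j G_{i j}` on coefficient vectors of length `m + 1`. -/
def gramForm (m : ℕ) (G : ℕ → ℕ → ℝ) (u v : ℕ → ℝ) : ℝ :=
  ∑ i ∈ Finset.range (m + 1), ∑ j ∈ Finset.range (m + 1), u i * v j * G i j

theorem gramForm_eq_sum (m : ℕ) (G : ℕ → ℕ → ℝ) (u v : ℕ → ℝ) :
    gramForm m G u v =
      ∑ j ∈ Finset.range (m + 1), (∑ i ∈ Finset.range (m + 1), u i * G i j) * v j := by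
  rw [gramForm, Finset.sum_comm]
  refine Finset.sum_congr rfl fun j _ => ?_
  rw [Finset.sum_mul]
  exact Finset.sum_congr rfl fun i _ => by ring

theorem gramForm_comm {m : ℕ} {G : ℕ → ℕ → ℝ} (hG : ∀ i j, G i j = G j i) (u v : ℕ → ℝ) :
    gramForm m G u v = gramForm m G v u := by
  rw [gramForm, gramForm, Finset.sum_comm]
  exact Finset.sum_congr rfl fun j _ => Finset.sum_congr rfl fun i _ => by rw [hG i j]; ring

theorem gramForm_sub_sub {m : ℕ} {G : ℕ → ℕ → ℝ} (hG : ∀ i j, G i j = G j i) (u w : ℕ → ℝ) :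
    gramForm m G (u - w) (u - w)
      = gramForm m G u u - 2 * gramForm m G u w + gramForm m G w w := by
  have h := gramForm_comm (m := m) hG u w
  have : gramForm m G (u - w) (u - w)
      = gramForm m G u u - gramForm m G u w - gramForm m G w u + gramForm m G w w := by
    simp only [gramForm, ← Finset.sum_sub_distrib, ← Finset.sum_add_distrib, Pi.sub_apply]
    exact Finset.sum_congr rfl fun i _ => Finset.sum_congr rfl fun j _ => by ring
  rw [this, ← h]; ring

/-- The invariant of Gaussian elimination without pivoting on `[G | 1]`: with `E` the left half and
`P` the right half of the tableau, `E = P G`, `P` is unit lower triangular, and in the first `k`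
columns `E` vanishes below the diagonal. -/
theorem eliminate_invariant {m : ℕ} {G : ℕ → ℕ → ℝ} (hG : ∀ i j, G i j = G j i)
    (hker : ∀ u, gramForm m G u u = 0 →
      ∀ j < m + 1, ∑ l ∈ Finset.range (m + 1), u l * G l j = 0) (k : ℕ) (hk : k ≤ m) :
    (∀ i < m + 1, ∀ j < m + 1, eliminate (augment m G) k i j =
        ∑ l ∈ Finset.range (m + 1), eliminate (augment m G) k i (m + 1 + l) * G l j) ∧
      (∀ i < m + 1, eliminate (augment m G) k i (m + 1 + i) = 1 ∧
        ∀ l, i < l → eliminate (augment m G) k i (m + 1 + l) = 0) ∧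
      ∀ i < m + 1, ∀ j, j < k → j < i → eliminate (augment m G) k i j = 0 := by
  induction k with
  | zero =>
    refine ⟨fun i hi j hj => ?_, fun i _ => ⟨?_, fun l hl => ?_⟩, fun i _ j hj => by omega⟩
    · rw [Finset.sum_eq_single_of_mem i (Finset.mem_range.2 hi)]
      · simp only [eliminate, augment]
        rw [if_pos hj, if_neg (by omega), if_pos trivial, one_mul]
      · intro l _ hl
        simp only [eliminate, augment]
        rw [if_neg (by omega), if_neg (by omega), zero_mul]
    · simp only [eliminate, augment]
      rw [if_neg (by omega), if_pos trivial]
    · simp only [eliminate, augment]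
      rw [if_neg (by omega), if_neg (by omega)]
  | succ k ih =>
    obtain ⟨h1, h2, h3⟩ := ih (by omega)
    generalize hE : eliminate (augment m G) k = E at h1 h2 h3
    have hlt : ∀ i j, k < i → eliminate (augment m G) (k + 1) i j
        = E i j - E i k / E k k * E k j := fun i j h => by
      rw [← hE]; exact RegressionProgram.eliminate_succ_of_lt _ h j
    have hle : ∀ i j, i ≤ k → eliminate (augment m G) (k + 1) i j = E i j := fun i j h => by
      rw [← hE]; exact RegressionProgram.eliminate_succ_of_le _ h j
    -- row `k` of `P` only meets column `k` of a row of `E` whose first `k` entries vanish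
    have hrow : ∀ i < m + 1, k ≤ i →
        ∑ j ∈ Finset.range (m + 1), E i j * E k (m + 1 + j) = E i k := by
      intro i hi hki
      rw [Finset.sum_eq_single_of_mem k (Finset.mem_range.2 (by omega)),
        (h2 k (by omega)).1, mul_one]
      intro j _ hj
      rcases lt_or_gt_of_ne hj with h | h
      · rw [h3 i hi j h (by omega), zero_mul]
      · rw [(h2 k (by omega)).2 j h, mul_zero]
    have hpivot : E k k = 0 → ∀ i < m + 1, k < i → E i k = 0 := by
      intro h0 i hi hki
      have hform : gramForm m G (fun l => E k (m + 1 + l)) (fun l => E k (m + 1 + l)) = 0 := by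
        rw [gramForm_eq_sum, ← h0, ← hrow k (by omega) le_rfl]
        exact Finset.sum_congr rfl fun j hj => by
          rw [h1 k (by omega) j (Finset.mem_range.1 hj)]
      have hzero : ∀ j < m + 1, E k j = 0 := fun j hj => by
        rw [h1 k (by omega) j hj]; exact hker _ hform j hj
      rw [← hrow i hi hki.le]
      calc ∑ j ∈ Finset.range (m + 1), E i j * E k (m + 1 + j)
          = gramForm m G (fun l => E i (m + 1 + l)) (fun l => E k (m + 1 + l)) := by
            rw [gramForm_eq_sum]
            exact Finset.sum_congr rfl fun j hj => by rw [h1 i hi j (Finset.mem_range.1 hj)]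
        _ = 0 := by
            rw [gramForm_comm hG, gramForm_eq_sum]
            refine Finset.sum_eq_zero fun j hj => ?_
            rw [← h1 k (by omega) j (Finset.mem_range.1 hj), hzero j (Finset.mem_range.1 hj),
              zero_mul]
    refine ⟨fun i hi j hj => ?_, fun i hi => ?_, fun i hi j hjk hji => ?_⟩
    · rcases lt_or_ge k i with h | h
      · simp only [hlt i _ h, sub_mul, Finset.sum_sub_distrib, mul_assoc, ← Finset.mul_sum]
        rw [← h1 i hi j hj, ← h1 k (by omega) j hj]
      · simp only [hle i _ h]
        exact h1 i hi j hj
    · rcases lt_or_ge k i with h | h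
      · simp only [hlt i _ h]
        refine ⟨?_, fun l hl => ?_⟩
        · rw [(h2 i hi).1, (h2 k (by omega)).2 i h]; ring
        · rw [(h2 i hi).2 l hl, (h2 k (by omega)).2 l (by omega)]; ring
      · simp only [hle i _ h]
        exact h2 i hi
    · rcases lt_or_ge k i with h | h
      · rw [hlt i _ h]
        rcases Nat.lt_succ_iff_lt_or_eq.1 hjk with hj | rfl
        · rw [h3 i hi j hj hji, h3 k (by omega) j hj hj]; ring
        · by_cases h0 : E j j = 0
          · rw [hpivot h0 i hi h]; ring
          · rw [div_mul_cancel₀ _ h0, sub_self]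
      · rw [hle i _ h]
        exact h3 i hi j (by omega) hji

/-! ### The sampled regression problem -/

section
variable {d m : ℕ} {B : Matrix (Fin d) (Fin d) ℝ} {f : Fin m → ℝ}

/-- The combination of the `m + 1` columns of the regression problem with coefficients `u`, at the
position `ω`. -/
noncomputable def combination (B : Matrix (Fin d) (Fin d) ℝ) (f : Fin m → ℝ) (u : ℕ → ℝ)
    (ω : ℕ × ℕ) : ℂ :=
  ∑ i ∈ Finset.range (m + 1), (u i : ℂ) * designRow B f ω i

theorem gramForm_rowGram (u v : ℕ → ℝ) (ω : ℕ × ℕ) :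
    gramForm m (rowGram B f ω) u v =
      (combination B f u ω).re * (combination B f v ω).re +
        (combination B f u ω).im * (combination B f v ω).im := by
  simp only [gramForm, rowGram, combination, Complex.re_sum, Complex.im_sum, Complex.mul_re,
    Complex.mul_im, Complex.ofReal_re, Complex.ofReal_im, zero_mul, sub_zero, add_zero]
  rw [Finset.sum_mul_sum, Finset.sum_mul_sum, ← Finset.sum_add_distrib]
  refine Finset.sum_congr rfl fun i _ => ?_
  rw [← Finset.sum_add_distrib]
  exact Finset.sum_congr rfl fun j _ => by ring

theorem gramForm_rowGram_self (u : ℕ → ℝ) (ω : ℕ × ℕ) :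
    gramForm m (rowGram B f ω) u u = ‖combination B f u ω‖ ^ 2 := by
  rw [gramForm_rowGram, ← Complex.normSq_eq_norm_sq, Complex.normSq_apply]

theorem gramForm_sampledGram_nil (u v : ℕ → ℝ) : gramForm m (sampledGram B f []) u v = 0 := by
  simp [gramForm, sampledGram]

theorem gramForm_sampledGram_cons (ω : ℕ × ℕ) (ℓ : List (ℕ × ℕ)) (u v : ℕ → ℝ) :
    gramForm m (sampledGram B f (ω :: ℓ)) u v =
      gramForm m (sampledGram B f ℓ) u v + gramForm m (rowGram B f ω) u v := by
  rw [RegressionProgram.sampledGram_cons]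
  simp only [gramForm, mul_add, Finset.sum_add_distrib]

theorem gramForm_sampledGram_self_nonneg (ℓ : List (ℕ × ℕ)) (u : ℕ → ℝ) :
    0 ≤ gramForm m (sampledGram B f ℓ) u u := by
  induction ℓ with
  | nil => rw [gramForm_sampledGram_nil]
  | cons ω ℓ ih =>
    rw [gramForm_sampledGram_cons, gramForm_rowGram_self]
    positivity

theorem gramForm_sampledGram_eq_zero_left {ℓ : List (ℕ × ℕ)} {u : ℕ → ℝ}
    (hu : ∀ ω ∈ ℓ, combination B f u ω = 0) (v : ℕ → ℝ) :
    gramForm m (sampledGram B f ℓ) u v = 0 := by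
  induction ℓ with
  | nil => rw [gramForm_sampledGram_nil]
  | cons ω ℓ ih =>
    rw [gramForm_sampledGram_cons, ih fun ω' h => hu ω' (List.mem_cons_of_mem _ h),
      gramForm_rowGram, hu ω List.mem_cons_self]
    simp

theorem combination_eq_zero_of_gramForm_eq_zero {ℓ : List (ℕ × ℕ)} {u : ℕ → ℝ}
    (hu : gramForm m (sampledGram B f ℓ) u u = 0) : ∀ ω ∈ ℓ, combination B f u ω = 0 := by
  induction ℓ with
  | nil => simp
  | cons ω ℓ ih =>
    rw [gramForm_sampledGram_cons, gramForm_rowGram_self] at hu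
    have h1 := gramForm_sampledGram_self_nonneg (B := B) (f := f) ℓ u
    have h2 : 0 ≤ ‖combination B f u ω‖ ^ 2 := by positivity
    intro ω' hω'
    rcases List.mem_cons.1 hω' with rfl | h
    · have : ‖combination B f u ω'‖ ^ 2 = 0 := by linarith
      simpa using this
    · exact ih (by linarith) ω' h

theorem sampledGram_comm (ℓ : List (ℕ × ℕ)) (i j : ℕ) :
    sampledGram B f ℓ i j = sampledGram B f ℓ j i := by
  simp only [sampledGram, rowGram, mul_comm]

theorem sampledGram_eq_zero (ℓ : List (ℕ × ℕ)) {i j : ℕ} (hj : m < j) :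
    sampledGram B f ℓ i j = 0 := by
  simp [sampledGram, rowGram, RegressionProgram.designRow_eq_zero hj]

/-- The last row of the eliminated tableau is the residual of the sampled regression problem: it is
orthogonal to the `m` columns of the design matrix. -/
theorem eliminate_sampledGram_orthogonal (ℓ : List (ℕ × ℕ)) :
    eliminate (augment m (sampledGram B f ℓ)) m m (m + 1 + m) = 1 ∧
      ∀ j < m, ∑ l ∈ Finset.range (m + 1),
        eliminate (augment m (sampledGram B f ℓ)) m m (m + 1 + l) * sampledGram B f ℓ l j = 0 := by
  have hker : ∀ u, gramForm m (sampledGram B f ℓ) u u = 0 →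
      ∀ j < m + 1, ∑ l ∈ Finset.range (m + 1), u l * sampledGram B f ℓ l j = 0 := by
    intro u hu j hj
    have h := gramForm_sampledGram_eq_zero_left (combination_eq_zero_of_gramForm_eq_zero hu)
      (Pi.single j 1)
    rw [gramForm_eq_sum] at h
    simpa [Pi.single_apply, Nat.lt_succ_iff.1 hj] using h
  obtain ⟨h1, h2, h3⟩ := eliminate_invariant (sampledGram_comm ℓ) hker m le_rfl
  refine ⟨(h2 m (by omega)).1, fun j hj => ?_⟩
  rw [← h1 m (by omega) j (by omega), h3 m (by omega) j hj hj]

end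

/-! ### The regression problem as a least squares problem -/

section
variable {d m : ℕ} {B : Matrix (Fin d) (Fin d) ℝ} {f : Fin m → ℝ}

/-- The vector `(D_0, …, D_{m - 1}, x)`, extended by `0`. -/
noncomputable def coefficientVector (D : Fin m → ℝ) (x : ℝ) (j : ℕ) : ℝ :=
  if h : j < m then D ⟨j, h⟩ else if j = m then x else 0

/-- The design map `D ↦ F D F^*` of the regression problem, as a real linear map into the complex
`d × d` matrices with the Frobenius norm. -/
noncomputable def designMap (d : ℕ) {m : ℕ} (f : Fin m → ℝ) :
    (Fin m → ℝ) →ₗ[ℝ] EuclideanSpace ℂ (Fin d × Fin d) where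
  toFun D := WithLp.toLp 2 fun ω => exponentialSum f D ((ω.1 : ℕ) - (ω.2 : ℕ))
  map_add' D E := by
    ext ω
    simp [exponentialSum, add_mul, Finset.sum_add_distrib]
  map_smul' c D := by
    ext ω
    simp [exponentialSum, Finset.mul_sum, mul_assoc]

/-- The target `B` of the regression problem. -/
noncomputable def target (B : Matrix (Fin d) (Fin d) ℝ) : EuclideanSpace ℂ (Fin d × Fin d) :=
  WithLp.toLp 2 fun ω => (B ω.1 ω.2 : ℂ)

@[simp] theorem designMap_apply (D : Fin m → ℝ) (ω : Fin d × Fin d) :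
    designMap d f D ω = exponentialSum f D ((ω.1 : ℕ) - (ω.2 : ℕ)) := rfl

@[simp] theorem target_apply (ω : Fin d × Fin d) : target B ω = (B ω.1 ω.2 : ℂ) := rfl

theorem inner_eq_sum_re_im (x y : EuclideanSpace ℂ (Fin d × Fin d)) :
    inner ℝ x y = ∑ ω, ((x ω).re * (y ω).re + (x ω).im * (y ω).im) := by
  rw [PiLp.inner_apply]
  refine Finset.sum_congr rfl fun ω _ => ?_
  rw [Complex.inner]
  simp [Complex.mul_re]
  ring

theorem phase_mul_conj_phase {s t : ℕ} (hs : s < d) (ht : t < d) (j : Fin m) :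
    phase d f s j * (starRingEnd ℂ) (phase d f t j) =
      Complex.exp (2 * Real.pi * Complex.I * (f j : ℂ) * (((s : ℤ) - (t : ℤ) : ℤ) : ℂ)) := by
  rw [phase, phase, dif_pos ⟨hs, j.2⟩, dif_pos ⟨ht, j.2⟩, ← Complex.exp_conj, ← Complex.exp_add]
  congr 1
  simp only [map_mul, Complex.conj_ofReal, Complex.conj_I, map_natCast, Complex.conj_ofNat]
  push_cast
  ring

theorem combination_coefficientVector (D : Fin m → ℝ) (x : ℝ) {s t : ℕ} (hs : s < d)
    (ht : t < d) :
    combination B f (coefficientVector D x) (s, t) =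
      x * B ⟨s, hs⟩ ⟨t, ht⟩ + exponentialSum f D (s - t) := by
  rw [combination, Finset.sum_range_succ, add_comm, Finset.sum_range]
  congr 1
  · simp [coefficientVector, designRow, hs, ht]
  · rw [exponentialSum]
    refine Finset.sum_congr rfl fun j _ => ?_
    rw [← phase_mul_conj_phase hs ht]
    simp [coefficientVector, designRow, j.2.ne]

theorem combination_eq_zero_of_not_lt (u : ℕ → ℝ) {ω : ℕ × ℕ} (h : ¬ (ω.1 < d ∧ ω.2 < d)) :
    combination B f u ω = 0 := by
  refine Finset.sum_eq_zero fun j _ => ?_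
  rcases not_and_or.1 h with h | h <;> simp [designRow, phase, h]

/-- Rows outside the square vanish, so the columns only have to be compared on the square. -/
theorem combination_coefficientVector_eq (D : Fin m → ℝ) (x : ℝ) (ω : ℕ × ℕ) :
    combination B f (coefficientVector D x) ω =
      if h : ω.1 < d ∧ ω.2 < d then
        (x • target B + designMap d f D) (⟨ω.1, h.1⟩, ⟨ω.2, h.2⟩) else 0 := by
  split_ifs with h
  · refine (combination_coefficientVector D x h.1 h.2).trans ?_
    simp
  · exact combination_eq_zero_of_not_lt _ h

theorem sum_gramForm_rowGram (D E : Fin m → ℝ) (x y : ℝ) :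
    ∑ s ∈ Finset.range d, ∑ t ∈ Finset.range d, gramForm m (rowGram B f (s, t))
        (coefficientVector D x) (coefficientVector E y) =
      inner ℝ (x • target B + designMap d f D) (y • target B + designMap d f E) := by
  rw [inner_eq_sum_re_im, Fintype.sum_prod_type, Finset.sum_range]
  refine Finset.sum_congr rfl fun s _ => ?_
  rw [Finset.sum_range]
  refine Finset.sum_congr rfl fun t _ => ?_
  rw [gramForm_rowGram, combination_coefficientVector_eq, combination_coefficientVector_eq,
    dif_pos ⟨s.2, t.2⟩, dif_pos ⟨s.2, t.2⟩]

theorem regressionCost_eq_norm (D : Fin m → ℝ) :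
    regressionCost B f D = ‖target B - designMap d f D‖ := by
  rw [regressionCost, Matrix.frobenius_norm_def, EuclideanSpace.norm_eq, Real.sqrt_eq_rpow,
    Fintype.sum_prod_type]
  simp only [Real.rpow_two]
  congr 1
  refine Finset.sum_congr rfl fun s _ => Finset.sum_congr rfl fun t _ => ?_
  congr 2
  rw [Matrix.sub_apply, Matrix.diagonal_map (by simp), Matrix.mul_apply]
  simp only [PiLp.sub_apply, target_apply, designMap_apply, Matrix.map_apply, exponentialSum]
  congr 1
  refine Finset.sum_congr rfl fun j _ => ?_
  rw [Matrix.mul_diagonal, Matrix.conjTranspose_apply, ← phase_mul_conj_phase s.2 t.2, phase,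
    phase, dif_pos ⟨s.2, j.2⟩, dif_pos ⟨t.2, j.2⟩]
  simp only [fourierMatrix, Complex.star_def, Fin.eta]
  ring

/-- The minimum of the regression problem is attained, at the orthogonal projection of the target to
the range of the design map. -/
theorem exists_forall_regressionCost_le (B : Matrix (Fin d) (Fin d) ℝ) (f : Fin m → ℝ) :
    ∃ Dopt : Fin m → ℝ, ∀ D, regressionCost B f Dopt ≤ regressionCost B f D := by
  obtain ⟨_, ⟨Dopt, rfl⟩, h⟩ := Submodule.exists_norm_eq_iInf_of_complete_subspace
    (LinearMap.range (designMap d f)) (Submodule.complete_of_finiteDimensional _) (target B)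
  refine ⟨Dopt, fun D => ?_⟩
  rw [regressionCost_eq_norm, regressionCost_eq_norm, h]
  exact ciInf_le (f := fun w : LinearMap.range (designMap d f) => ‖target B - w‖)
    ⟨0, by rintro _ ⟨w, rfl⟩; exact norm_nonneg _⟩ ⟨_, D, rfl⟩

/-- At most `m` diagonals whose images under the design map are an orthogonal basis of its range.
Their images have length `d`, so that they are orthonormal for the average over the square. -/
theorem exists_orthogonal_diagonals (d : ℕ) (hd : d ≠ 0) (f : Fin m → ℝ) :
    ∃ p ≤ m, ∃ U : Fin p → Fin m → ℝ,
      (∀ i j, inner ℝ (designMap d f (U i)) (designMap d f (U j))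
        = if i = j then (d : ℝ) ^ 2 else 0) ∧
      ∀ D, ∃ c : Fin p → ℝ, designMap d f D = ∑ i, c i • designMap d f (U i) := by
  have hd' : (d : ℝ) ≠ 0 := by exact_mod_cast hd
  set V := LinearMap.range (designMap d f)
  refine ⟨Module.finrank ℝ V, (LinearMap.finrank_range_le _).trans (by simp), ?_⟩
  have b := stdOrthonormalBasis ℝ V
  have hU : ∀ i, ∃ D, designMap d f D = (d : ℝ) • (b i : EuclideanSpace ℂ (Fin d × Fin d)) :=
    fun i => ((d : ℝ) • b i).2
  choose U hU using hU
  refine ⟨U, fun i j => ?_, fun D => ?_⟩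
  · rw [hU, hU, inner_smul_left, inner_smul_right, ← Submodule.coe_inner,
      orthonormal_iff_ite.1 b.orthonormal]
    split_ifs <;> simp [sq]
  · have hD : designMap d f D ∈ V := ⟨D, rfl⟩
    refine ⟨fun i => (d : ℝ)⁻¹ * b.repr ⟨_, hD⟩ i, ?_⟩
    have h := congrArg Subtype.val (b.sum_repr ⟨_, hD⟩)
    rw [Submodule.coe_sum] at h
    refine h.symm.trans (Finset.sum_congr rfl fun i _ => ?_)
    rw [hU, smul_smul, mul_right_comm, inv_mul_cancel₀ hd', one_mul]
    rfl

/-- The leverage bound in terms of the Frobenius norm. -/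
theorem norm_designMap_apply_sq_mul_le (D : Fin m → ℝ) (ω : Fin d × Fin d) :
    ‖designMap d f D ω‖ ^ 2 * (d : ℝ) ^ 2 ≤
      400 * ((m : ℝ) + 1) ^ 9 * ‖designMap d f D‖ ^ 2 := by
  refine (norm_exponentialSum_sq_mul_le f D ω.1.2 ω.2.2).trans (le_of_eq ?_)
  rw [EuclideanSpace.norm_sq_eq, Fintype.sum_prod_type, Finset.sum_range]
  congr 1
  refine Finset.sum_congr rfl fun s _ => ?_
  rw [Finset.sum_range]
  rfl

end

/-! ### The accuracy of the sampled problem -/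

section
variable {d m : ℕ} {B : Matrix (Fin d) (Fin d) ℝ} {f : Fin m → ℝ}

/-- The potential of a sampled Gram matrix `G` after `k` rounds. Its first part measures how far `G`
is from `k` times the identity, in the coordinates given by the diagonals `U`; its second part is
the weighted sampled cost of the coefficient vector `v`. -/
noncomputable def deviationPotential (m n : ℕ) {p : ℕ} (U : Fin p → Fin m → ℝ) (v : ℕ → ℝ)
    (β : ℝ) (k : ℕ) (G : ℕ → ℕ → ℝ) : ℝ :=
  4 / (n : ℝ) ^ 2 * ∑ i, ∑ j, (gramForm m G (coefficientVector (U i) 0)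
    (coefficientVector (U j) 0) - if i = j then (k : ℝ) else 0) ^ 2 + β * gramForm m G v v

theorem deviationPotential_nonneg (n : ℕ) {p : ℕ} (U : Fin p → Fin m → ℝ) (v : ℕ → ℝ)
    {β : ℝ} (hβ : 0 ≤ β) (k : ℕ) (ℓ : List (ℕ × ℕ)) :
    0 ≤ deviationPotential m n U v β k (sampledGram B f ℓ) := by
  have := gramForm_sampledGram_self_nonneg (B := B) (f := f) ℓ v
  unfold deviationPotential
  positivity

/-- The second moment of `z + (X - δ)` for a random variable `X` of mean `δ`, bounded by `K`. -/
theorem sum_add_sub_sq_le {ι : Type*} (S : Finset ι) {X : ι → ℝ} {δ K : ℝ} (z : ℝ)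
    (hsum : ∑ ω ∈ S, X ω = S.card * δ) (hX : ∀ ω ∈ S, X ω ^ 2 ≤ K ^ 2) :
    ∑ ω ∈ S, (z + X ω - δ) ^ 2 ≤ S.card * (z ^ 2 + K ^ 2) := by
  have h1 : ∑ ω ∈ S, (z + X ω - δ) ^ 2
      = S.card * (z - δ) ^ 2 + 2 * (z - δ) * ∑ ω ∈ S, X ω + ∑ ω ∈ S, X ω ^ 2 := by
    rw [Finset.mul_sum, ← nsmul_eq_mul, ← Finset.sum_const, ← Finset.sum_add_distrib,
      ← Finset.sum_add_distrib]
    exact Finset.sum_congr rfl fun ω _ => by ring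
  have h2 : ∑ ω ∈ S, X ω ^ 2 ≤ S.card * K ^ 2 := by
    rw [← nsmul_eq_mul]
    exact Finset.sum_le_card_nsmul S _ _ hX
  rw [h1, hsum]
  have : 0 ≤ (S.card : ℝ) * δ ^ 2 := by positivity
  linarith [this, h2]

/-- By the leverage bound, the contributions of single rows to the Gram matrix are bounded. -/
theorem sq_gramForm_rowGram_le (hd : d ≠ 0) {D E : Fin m → ℝ}
    (hD : ‖designMap d f D‖ ^ 2 = (d : ℝ) ^ 2) (hE : ‖designMap d f E‖ ^ 2 = (d : ℝ) ^ 2)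
    {s t : ℕ} (hs : s < d) (ht : t < d) :
    gramForm m (rowGram B f (s, t)) (coefficientVector D 0) (coefficientVector E 0) ^ 2 ≤
      (400 * ((m : ℝ) + 1) ^ 9) ^ 2 := by
  have hd' : (0 : ℝ) < (d : ℝ) ^ 2 := by
    have : (0 : ℝ) < d := by exact_mod_cast Nat.pos_of_ne_zero hd
    positivity
  have key : ∀ D : Fin m → ℝ, ‖designMap d f D‖ ^ 2 = (d : ℝ) ^ 2 →
      ‖combination B f (coefficientVector D 0) (s, t)‖ ^ 2 ≤ 400 * ((m : ℝ) + 1) ^ 9 := by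
    intro D hD
    have h := norm_designMap_apply_sq_mul_le D (⟨s, hs⟩, ⟨t, ht⟩) (f := f)
    rw [hD] at h
    rw [combination_coefficientVector_eq, dif_pos ⟨hs, ht⟩, zero_smul, zero_add]
    exact le_of_mul_le_mul_right h hd'
  have h1 := key D hD
  have h2 := key E hE
  rw [gramForm_rowGram]
  generalize combination B f (coefficientVector D 0) (s, t) = x at h1
  generalize combination B f (coefficientVector E 0) (s, t) = y at h2
  rw [← Complex.normSq_eq_norm_sq, Complex.normSq_apply] at h1 h2
  calc (x.re * y.re + x.im * y.im) ^ 2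
      ≤ (x.re * x.re + x.im * x.im) * (y.re * y.re + y.im * y.im) := by
        nlinarith [sq_nonneg (x.re * y.im - x.im * y.re)]
    _ ≤ (400 * ((m : ℝ) + 1) ^ 9) * (400 * ((m : ℝ) + 1) ^ 9) :=
        mul_le_mul h1 h2 (by nlinarith [sq_nonneg y.re, sq_nonneg y.im]) (by positivity)
    _ = _ := by ring

/-- The expected growth of the potential in one round. -/
theorem sum_deviationPotential_le (hd : d ≠ 0) (n : ℕ) {p : ℕ} {U : Fin p → Fin m → ℝ}
    (hU : ∀ i j, inner ℝ (designMap d f (U i)) (designMap d f (U j))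
        = if i = j then (d : ℝ) ^ 2 else 0) (D : Fin m → ℝ) (β : ℝ) (k : ℕ)
    (ℓ : List (ℕ × ℕ)) :
    ∑ s ∈ Finset.range d, ∑ t ∈ Finset.range d,
        deviationPotential m n U (coefficientVector D 1) β (k + 1)
          (sampledGram B f ((s, t) :: ℓ)) ≤
      (d : ℝ) ^ 2 * (deviationPotential m n U (coefficientVector D 1) β k (sampledGram B f ℓ) +
        (4 / (n : ℝ) ^ 2 * ((p : ℝ) ^ 2 * (400 * ((m : ℝ) + 1) ^ 9) ^ 2) +
          β * (‖target B + designMap d f D‖ ^ 2 / (d : ℝ) ^ 2))) := by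
  have hd' : (d : ℝ) ≠ 0 := by exact_mod_cast hd
  have hnorm : ∀ i, ‖designMap d f (U i)‖ ^ 2 = (d : ℝ) ^ 2 := fun i => by
    rw [← real_inner_self_eq_norm_sq, hU, if_pos rfl]
  have hcard : ((Finset.range d ×ˢ Finset.range d).card : ℝ) = (d : ℝ) ^ 2 := by
    rw [Finset.card_product, Finset.card_range]; push_cast; ring
  set K : ℝ := 400 * ((m : ℝ) + 1) ^ 9
  have hpair : ∀ i j, ∑ ω ∈ Finset.range d ×ˢ Finset.range d,
      (gramForm m (sampledGram B f (ω :: ℓ)) (coefficientVector (U i) 0)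
        (coefficientVector (U j) 0) - if i = j then ((k + 1 : ℕ) : ℝ) else 0) ^ 2 ≤
      (d : ℝ) ^ 2 * ((gramForm m (sampledGram B f ℓ) (coefficientVector (U i) 0)
        (coefficientVector (U j) 0) - if i = j then (k : ℝ) else 0) ^ 2 + K ^ 2) := by
    intro i j
    have hs := sum_gramForm_rowGram (B := B) (f := f) (U i) (U j) 0 0
    rw [zero_smul, zero_add, zero_add, hU, ← Finset.sum_product'] at hs
    rw [← hcard]
    refine le_trans (le_of_eq (Finset.sum_congr rfl fun ω _ => ?_))
      (sum_add_sub_sq_le (Finset.range d ×ˢ Finset.range d)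
      (X := fun ω => gramForm m (rowGram B f (ω.1, ω.2)) (coefficientVector (U i) 0)
        (coefficientVector (U j) 0)) (δ := if i = j then 1 else 0) (K := K) _ ?_ ?_)
    · rw [gramForm_sampledGram_cons]
      split_ifs <;> push_cast <;> ring
    · rw [hs, hcard]; simp
    · intro ω hω
      obtain ⟨h1, h2⟩ := Finset.mem_product.1 hω
      exact sq_gramForm_rowGram_le hd (hnorm i) (hnorm j) (Finset.mem_range.1 h1)
        (Finset.mem_range.1 h2)
  have htarget := sum_gramForm_rowGram (B := B) (f := f) D D 1 1
  rw [one_smul, real_inner_self_eq_norm_sq, ← Finset.sum_product'] at htarget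
  rw [← Finset.sum_product']
  simp only [deviationPotential, Finset.sum_add_distrib, ← Finset.mul_sum]
  have h1 : ∑ ω ∈ Finset.range d ×ˢ Finset.range d, ∑ i, ∑ j,
      (gramForm m (sampledGram B f ((ω.1, ω.2) :: ℓ)) (coefficientVector (U i) 0)
        (coefficientVector (U j) 0) - if i = j then ((k + 1 : ℕ) : ℝ) else 0) ^ 2 ≤
      (d : ℝ) ^ 2 * (∑ i, ∑ j, (gramForm m (sampledGram B f ℓ) (coefficientVector (U i) 0)
        (coefficientVector (U j) 0) - if i = j then (k : ℝ) else 0) ^ 2 +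
          (p : ℝ) ^ 2 * K ^ 2) := by
    rw [Finset.sum_comm]
    simp only [Finset.sum_comm (s := Finset.range d ×ˢ Finset.range d)]
    refine (Finset.sum_le_sum fun i _ => Finset.sum_le_sum fun j _ => hpair i j).trans
      (le_of_eq ?_)
    simp only [← Finset.mul_sum, Finset.sum_add_distrib, Finset.sum_const, Finset.card_univ,
      Fintype.card_fin, nsmul_eq_mul]
    ring
  have h2 : ∑ ω ∈ Finset.range d ×ˢ Finset.range d,
      gramForm m (sampledGram B f ((ω.1, ω.2) :: ℓ)) (coefficientVector D 1)
        (coefficientVector D 1) = (d : ℝ) ^ 2 * gramForm m (sampledGram B f ℓ)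
          (coefficientVector D 1) (coefficientVector D 1) +
            ‖target B + designMap d f D‖ ^ 2 := by
    simp only [gramForm_sampledGram_cons]
    rw [Finset.sum_add_distrib, htarget, Finset.sum_const, nsmul_eq_mul, hcard]
  rw [h2]
  refine (add_le_add_left (mul_le_mul_of_nonneg_left h1 (by positivity)) _).trans (le_of_eq ?_)
  field_simp
  ring

/-- If the sampled Gram matrix is close to `n` times the identity in the coordinates given by `U`,
then sampling does not lose more than half of the squared norm of any element of the range. -/
theorem norm_designMap_sq_le_gramForm (hd : d ≠ 0) {n p : ℕ} {U : Fin p → Fin m → ℝ}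
    (hU : ∀ i j, inner ℝ (designMap d f (U i)) (designMap d f (U j))
        = if i = j then (d : ℝ) ^ 2 else 0)
    (hspan : ∀ D, ∃ c : Fin p → ℝ, designMap d f D = ∑ i, c i • designMap d f (U i))
    {ℓ : List (ℕ × ℕ)}
    (hℓ : ∑ i, ∑ j, (gramForm m (sampledGram B f ℓ) (coefficientVector (U i) 0)
      (coefficientVector (U j) 0) - if i = j then (n : ℝ) else 0) ^ 2 ≤ ((n : ℝ) / 2) ^ 2)
    (D : Fin m → ℝ) :
    (n : ℝ) / 2 * ‖designMap d f D‖ ^ 2 ≤ (d : ℝ) ^ 2 *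
      gramForm m (sampledGram B f ℓ) (coefficientVector D 0) (coefficientVector D 0) := by
  obtain ⟨c, hc⟩ := hspan D
  have hcomb : ∀ ω, combination B f (coefficientVector D 0) ω
      = ∑ i, (c i : ℂ) * combination B f (coefficientVector (U i) 0) ω := by
    intro ω
    simp only [combination_coefficientVector_eq, hc, zero_smul, zero_add]
    split_ifs with h
    · simp
    · simp
  have hform : gramForm m (sampledGram B f ℓ) (coefficientVector D 0) (coefficientVector D 0)
      = ∑ i, ∑ j, c i * c j * gramForm m (sampledGram B f ℓ) (coefficientVector (U i) 0)
        (coefficientVector (U j) 0) := by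
    clear hℓ
    induction ℓ with
    | nil => simp [gramForm_sampledGram_nil]
    | cons ω ℓ ih =>
      simp only [gramForm_sampledGram_cons, ih, mul_add, Finset.sum_add_distrib]
      congr 1
      simp only [gramForm_rowGram, hcomb, Complex.re_sum, Complex.im_sum, Complex.re_ofReal_mul,
        Complex.im_ofReal_mul]
      rw [Finset.sum_mul_sum, Finset.sum_mul_sum, ← Finset.sum_add_distrib]
      refine Finset.sum_congr rfl fun i _ => ?_
      rw [← Finset.sum_add_distrib]
      exact Finset.sum_congr rfl fun j _ => by ring
  have hnorm : ‖designMap d f D‖ ^ 2 = (d : ℝ) ^ 2 * ∑ i, c i ^ 2 := by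
    rw [← real_inner_self_eq_norm_sq, hc, sum_inner, Finset.mul_sum]
    refine Finset.sum_congr rfl fun i _ => ?_
    rw [inner_sum, Finset.sum_eq_single_of_mem i (Finset.mem_univ i)]
    · rw [inner_smul_left, inner_smul_right, hU, if_pos rfl]
      simp only [conj_trivial]
      ring
    · intro j _ hj
      rw [inner_smul_left, inner_smul_right, hU, if_neg hj.symm]
      simp
  rw [hnorm, hform]
  generalize hZ : (fun i j => gramForm m (sampledGram B f ℓ) (coefficientVector (U i) 0)
      (coefficientVector (U j) 0) - if i = j then (n : ℝ) else 0) = Z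
  have hZ' : ∀ i j, gramForm m (sampledGram B f ℓ) (coefficientVector (U i) 0)
      (coefficientVector (U j) 0) = Z i j + if i = j then (n : ℝ) else 0 := by
    intro i j; rw [← hZ]; ring
  simp only [hZ', add_sub_cancel_right] at hℓ ⊢
  set S := ∑ i, c i ^ 2 with hS
  have hS0 : 0 ≤ S := Finset.sum_nonneg fun i _ => sq_nonneg _
  have hsplit : ∑ i, ∑ j, c i * c j * (Z i j + if i = j then (n : ℝ) else 0)
      = ∑ i, ∑ j, c i * c j * Z i j + n * S := by
    simp only [mul_add, Finset.sum_add_distrib, hS, Finset.mul_sum]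
    congr 1
    refine Finset.sum_congr rfl fun i _ => ?_
    simp
    ring
  have hcs : (∑ i, ∑ j, c i * c j * Z i j) ^ 2 ≤ (S * ((n : ℝ) / 2)) ^ 2 := by
    have h := Finset.sum_mul_sq_le_sq_mul_sq (Finset.univ : Finset (Fin p × Fin p))
      (fun q => c q.1 * c q.2) (fun q => Z q.1 q.2)
    rw [Fintype.sum_prod_type, Fintype.sum_prod_type, Fintype.sum_prod_type] at h
    have h3 : ∑ i, ∑ j, (c i * c j) ^ 2 = S * S := by
      rw [hS, Finset.sum_mul_sum]
      exact Finset.sum_congr rfl fun i _ => Finset.sum_congr rfl fun j _ => by ring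
    dsimp only at h
    rw [h3] at h
    refine h.trans ?_
    rw [mul_pow, sq S]
    gcongr
  have habs := abs_le_of_sq_le_sq' hcs (by positivity)
  rw [hsplit]
  have hd2 : 0 ≤ (d : ℝ) ^ 2 := by positivity
  calc (n : ℝ) / 2 * ((d : ℝ) ^ 2 * S) = (d : ℝ) ^ 2 * (-(S * (n / 2)) + n * S) := by ring
    _ ≤ _ := mul_le_mul_of_nonneg_left (by linarith [habs.1]) hd2

/-- The output of the elimination minimizes the sampled cost. By Pythagoras, its distance from any
other diagonal is at most the sampled cost of the latter. -/
theorem gramForm_sub_le {ℓ : List (ℕ × ℕ)} {D' : Fin m → ℝ}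
    (hD' : ∀ j : Fin m, D' j =
      - eliminate (augment m (sampledGram B f ℓ)) m m (m + 1 + j)) (D : Fin m → ℝ) :
    gramForm m (sampledGram B f ℓ) (coefficientVector (D - D') 0) (coefficientVector (D - D') 0) ≤
      gramForm m (sampledGram B f ℓ) (coefficientVector (-D) 1) (coefficientVector (-D) 1) := by
  obtain ⟨h1, h2⟩ := eliminate_sampledGram_orthogonal (B := B) (f := f) ℓ
  have hrow : ∀ l ∈ Finset.range (m + 1), coefficientVector (-D') 1 l =
      eliminate (augment m (sampledGram B f ℓ)) m m (m + 1 + l) := by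
    intro l hl
    rw [coefficientVector]
    split_ifs with h h'
    · simp [hD']
    · rw [h', h1]
    · have := Finset.mem_range.1 hl; omega
  have hsub : coefficientVector (-D) 1
      = coefficientVector (-D') 1 - coefficientVector (D - D') 0 := by
    funext j
    simp only [coefficientVector, Pi.sub_apply, Pi.neg_apply]
    split_ifs <;> ring
  have hcross : gramForm m (sampledGram B f ℓ) (coefficientVector (-D') 1)
      (coefficientVector (D - D') 0) = 0 := by
    rw [gramForm_eq_sum]
    refine Finset.sum_eq_zero fun j hj => ?_
    rcases Nat.lt_succ_iff_lt_or_eq.1 (Finset.mem_range.1 hj) with h | h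
    · rw [Finset.sum_congr rfl fun l hl => by rw [hrow l hl], h2 j h, zero_mul]
    · rw [h]; simp [coefficientVector]
  have := gramForm_sampledGram_self_nonneg (B := B) (f := f) ℓ (coefficientVector (-D') 1)
  rw [hsub, gramForm_sub_sub (sampledGram_comm ℓ), hcross]
  linarith

/-- If the potential is below `1`, then sampling is accurate enough for the minimizer of the sampled
cost. The weight of the second part of the potential is chosen such that its mean is `1 / 200`. -/
theorem regressionCost_le_of_deviationPotential_lt_one (hd : d ≠ 0) {n p : ℕ} (hn : n ≠ 0)
    {U : Fin p → Fin m → ℝ}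
    (hU : ∀ i j, inner ℝ (designMap d f (U i)) (designMap d f (U j))
        = if i = j then (d : ℝ) ^ 2 else 0)
    (hspan : ∀ D, ∃ c : Fin p → ℝ, designMap d f D = ∑ i, c i • designMap d f (U i))
    {ℓ : List (ℕ × ℕ)} {D D' : Fin m → ℝ}
    (hlt : deviationPotential m n U (coefficientVector (-D) 1)
      ((d : ℝ) ^ 2 / (200 * n * ‖target B + designMap d f (-D)‖ ^ 2)) n (sampledGram B f ℓ) < 1)
    (hD' : ∀ j : Fin m, D' j =
      - eliminate (augment m (sampledGram B f ℓ)) m m (m + 1 + j)) :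
    regressionCost B f D' ≤ 21 * regressionCost B f D := by
  have hn' : (0 : ℝ) < n := by exact_mod_cast Nat.pos_of_ne_zero hn
  have hd' : (0 : ℝ) < d := by exact_mod_cast Nat.pos_of_ne_zero hd
  have hform := gramForm_sampledGram_self_nonneg (B := B) (f := f) ℓ (coefficientVector (-D) 1)
  have hle := gramForm_sub_le hD' D
  rw [regressionCost_eq_norm, regressionCost_eq_norm]
  have hres : target B - designMap d f D = target B + designMap d f (-D) := by
    rw [map_neg, sub_eq_add_neg]
  set R := ‖target B + designMap d f (-D)‖ ^ 2 with hR
  have hR0 : 0 ≤ R := by positivity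
  set q := gramForm m (sampledGram B f ℓ) (coefficientVector (-D) 1)
    (coefficientVector (-D) 1) with hq
  unfold deviationPotential at hlt
  have hZ0 : 0 ≤ ∑ i, ∑ j, (gramForm m (sampledGram B f ℓ) (coefficientVector (U i) 0)
      (coefficientVector (U j) 0) - if i = j then (n : ℝ) else 0) ^ 2 :=
    Finset.sum_nonneg fun i _ => Finset.sum_nonneg fun j _ => sq_nonneg _
  have hq1 : 0 ≤ (d : ℝ) ^ 2 / (200 * n * R) * q := by positivity
  have hZ1 := mul_nonneg (show 0 ≤ 4 / (n : ℝ) ^ 2 by positivity) hZ0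
  have hlower := norm_designMap_sq_le_gramForm hd hU hspan (B := B) (n := n) (ℓ := ℓ) (by
    have h : 4 / (n : ℝ) ^ 2 * ∑ i, ∑ j, (gramForm m (sampledGram B f ℓ)
      (coefficientVector (U i) 0) (coefficientVector (U j) 0) -
        if i = j then (n : ℝ) else 0) ^ 2 ≤ 1 := by linarith
    rw [div_mul_eq_mul_div, div_le_one (by positivity)] at h
    linarith) (D - D')
  have hupper : (d : ℝ) ^ 2 * q ≤ 200 * n * R := by
    rcases hR0.eq_or_lt with h0 | h0
    · -- the weight of the second part is `0` here, but then `D` fits the target exactly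
      have hv : target B + designMap d f (-D) = 0 := by
        rw [← norm_eq_zero, ← sq_eq_zero_iff, ← hR, ← h0]
      have : q = 0 := gramForm_sampledGram_eq_zero_left (fun ω _ => by
        rw [combination_coefficientVector_eq, one_smul, hv]; simp) _
      rw [this, ← h0]; simp
    · have h : (d : ℝ) ^ 2 / (200 * n * R) * q ≤ 1 := by linarith
      rwa [div_mul_eq_mul_div, div_le_one (by positivity)] at h
  have hdist : ‖designMap d f (D - D')‖ ≤ 20 * ‖target B + designMap d f (-D)‖ := by
    refine le_of_sq_le_sq ?_ (by positivity)
    rw [mul_pow, ← hR]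
    have h1 := mul_le_mul_of_nonneg_left hle (sq_nonneg (d : ℝ))
    have h2 : (n : ℝ) / 2 * ‖designMap d f (D - D')‖ ^ 2 ≤ n / 2 * (400 * R) := by
      linarith
    have := le_of_mul_le_mul_left h2 (by positivity)
    linarith
  have hsplit : target B - designMap d f D' = (target B - designMap d f D) +
      designMap d f (D - D') := by rw [map_sub]; abel
  calc ‖target B - designMap d f D'‖
      ≤ ‖target B - designMap d f D‖ + ‖designMap d f (D - D')‖ := by
        rw [hsplit]; exact norm_add_le _ _
    _ ≤ 21 * ‖target B - designMap d f D‖ := by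
        rw [hres]; linarith

/-- The expected potential after all rounds: the number of rounds is chosen such that both parts
contribute at most `1 / 200`. -/
theorem deviationPotential_growth_le {n p : ℕ} (hn : n = 128000000 * (m + 1) ^ 20) (hp : p ≤ m)
    {x y : ℝ} (hx : 0 ≤ x) :
    (n : ℝ) * (4 / (n : ℝ) ^ 2 * ((p : ℝ) ^ 2 * (400 * ((m : ℝ) + 1) ^ 9) ^ 2) +
      y ^ 2 / (200 * n * x) * (x / y ^ 2)) ≤ 1 / 100 := by
  have hn' : (n : ℝ) = 128000000 * ((m : ℝ) + 1) ^ 20 := by rw [hn]; push_cast; ring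
  have hpos : (0 : ℝ) < n := by clear hn; rw [hn']; positivity
  clear hn
  have h1 : (n : ℝ) * (4 / (n : ℝ) ^ 2 * ((p : ℝ) ^ 2 * (400 * ((m : ℝ) + 1) ^ 9) ^ 2))
      ≤ 1 / 200 := by
    have hpm : (p : ℝ) ≤ m + 1 := by
      have : (p : ℝ) ≤ m := by exact_mod_cast hp
      linarith
    have h : (p : ℝ) ^ 2 * (400 * ((m : ℝ) + 1) ^ 9) ^ 2 ≤
        ((m : ℝ) + 1) ^ 2 * (400 * ((m : ℝ) + 1) ^ 9) ^ 2 := by gcongr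
    calc (n : ℝ) * (4 / (n : ℝ) ^ 2 * ((p : ℝ) ^ 2 * (400 * ((m : ℝ) + 1) ^ 9) ^ 2))
        = 4 * ((p : ℝ) ^ 2 * (400 * ((m : ℝ) + 1) ^ 9) ^ 2) / n := by
          field_simp
      _ ≤ 1 / 200 := by
          rw [div_le_iff₀ hpos, hn']
          linarith
  have h2 : (n : ℝ) * (y ^ 2 / (200 * n * x) * (x / y ^ 2)) ≤ 1 / 200 := by
    rcases hx.eq_or_lt with rfl | hx
    · simp
    by_cases hy : y = 0
    · simp [hy]
    · apply le_of_eq; field_simp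
  linarith

theorem deviationPotential_zero (n : ℕ) {p : ℕ} (U : Fin p → Fin m → ℝ) (v : ℕ → ℝ) (β : ℝ) :
    deviationPotential m n U v β 0 (fun _ _ => 0) = 0 := by
  simp [deviationPotential, gramForm]

end

/-! ### Running time and probability of success -/

namespace RegressionProgram

open Program

/-- The program: sample the rows of the regression problem, then solve the sampled problem. -/
def regression : Program := .seq sampling solve

/-- A bound on the running time of the program. -/
def regressionTime (m : ℕ) : ℕ :=
  3 + 20 * (3 + (4 + (m + 1) * 8 + 4)) +
    (3 + 128000000 * (m + 1) ^ 20 * (3 + (3 + rowTime m) + 1)) + solveTime m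

theorem exists_polynomial_eq_regressionTime :
    ∃ P : Polynomial ℕ, ∀ m, P.eval m = regressionTime m := by
  refine ⟨3 + 20 * (3 + (4 + (Polynomial.X + 1) * 8 + 4)) +
    (3 + 128000000 * (Polynomial.X + 1) ^ 20 * (3 + (3 + (5 + Polynomial.X * 61 + 13 +
      (7 + (Polynomial.X + 1) * (7 + (Polynomial.X + 1) * 37 + 7)))) + 1)) +
    (7 + (Polynomial.X + 1) * 18 + ((5 + Polynomial.X * (8 + Polynomial.X *
      (19 + (9 + (2 * Polynomial.X + 2) * 37) + 7) + 7)) + (5 + Polynomial.X * 22))),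
    fun m => ?_⟩
  simp only [Polynomial.eval_add, Polynomial.eval_mul, Polynomial.eval_pow, Polynomial.eval_X,
    Polynomial.eval_ofNat, Polynomial.eval_one, regressionTime, rowTime, solveTime]

variable {d m : ℕ}

theorem ensures_regression (B : Matrix (Fin d) (Fin d) ℝ) (f : Fin m → ℝ) :
    regression.Ensures B f Memory.init (fun _ => True) (regressionTime m) :=
  ensures_sampling.seq fun _ ⟨ℓ, hℓ⟩ =>
    (ensures_solve hℓ fun _ _ h => sampledGram_eq_zero ℓ h).mono (fun _ _ => trivial) le_rfl

/-- With probability at least `0.99` the output is as good as any given diagonal, up to a factor. -/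
theorem one_le_toOuterMeasure_regression_add (hd : d ≠ 0) (B : Matrix (Fin d) (Fin d) ℝ)
    (f D : Fin m → ℝ) :
    1 ≤ (regression.run B f Memory.init).toOuterMeasure {o | regressionCost B f
      (fun j : Fin m => o.1.reals 0 j 0) ≤ 21 * regressionCost B f D} +
        ENNReal.ofReal (1 / 100) := by
  obtain ⟨p, hp, U, hU, hspan⟩ := exists_orthogonal_diagonals d hd f
  have hβ : ∀ n : ℕ, 0 ≤ (d : ℝ) ^ 2 / (200 * n * ‖target B + designMap d f (-D)‖ ^ 2) :=
    fun n => by positivity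
  have ha : ∀ n : ℕ, 0 ≤ 4 / (n : ℝ) ^ 2 * ((p : ℝ) ^ 2 * (400 * ((m : ℝ) + 1) ^ 9) ^ 2) +
      (d : ℝ) ^ 2 / (200 * n * ‖target B + designMap d f (-D)‖ ^ 2) *
        (‖target B + designMap d f (-D)‖ ^ 2 / (d : ℝ) ^ 2) := fun n => by positivity
  obtain ⟨n, hn⟩ : ∃ n, n = 128000000 * (m + 1) ^ 20 := ⟨_, rfl⟩
  have hn0 : n ≠ 0 :=
    hn ▸ mul_ne_zero (OfNat.ofNat_ne_zero _) (pow_ne_zero _ (Nat.succ_ne_zero m))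
  have hexp := expectation_sampling_le (B := B) (f := f) hd (deviationPotential m n U
    (coefficientVector (-D) 1)
    ((d : ℝ) ^ 2 / (200 * n * ‖target B + designMap d f (-D)‖ ^ 2))) (ha n)
    (deviationPotential_nonneg n U _ (hβ n))
    (sum_deviationPotential_le hd n hU (-D) _)
  rw [← hn, deviationPotential_zero, zero_add] at hexp
  refine one_le_toOuterMeasure_add_of_expectation_le (t := solveTime m)
    (Q := fun σ => regressionCost B f (fun j : Fin m => σ.reals 0 j 0) ≤ 21 * regressionCost B f D)
    (hexp.trans (ENNReal.ofReal_le_ofReal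
      (deviationPotential_growth_le hn hp (sq_nonneg _)))) fun o ho hlt => ?_
  obtain ⟨ℓ, hℓ⟩ := (ensures_sampling o ho).1
  rw [ENNReal.ofReal_lt_one, hℓ] at hlt
  refine (ensures_solve hℓ fun _ _ h => sampledGram_eq_zero ℓ h).mono (fun σ hσ => ?_) le_rfl
  exact regressionCost_le_of_deviationPotential_lt_one hd hn0 hU hspan hlt fun j => hσ j j.2

end RegressionProgram

open RegressionProgram in
theorem mainTheorem7 :
    ∃ (A : Program) (C : ℝ) (p : Polynomial ℕ),
      ∀ (d m : ℕ) (B : Matrix (Fin d) (Fin d) ℝ) (f : Fin m → ℝ),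
        Function.Injective f → (∀ j, f j ∈ Set.Icc (0 : ℝ) 1) →
          (∀ o ∈ (A.result B f).support, o.2 ≤ p.eval m) ∧
          ∃ Dopt : Fin m → ℝ,
            (∀ D : Fin m → ℝ, regressionCost B f Dopt ≤ regressionCost B f D) ∧
            (99 / 100 : ENNReal) ≤ (A.result B f).toOuterMeasure
              {o | regressionCost B f o.1 ≤ C * regressionCost B f Dopt} := by
  obtain ⟨P, hP⟩ := exists_polynomial_eq_regressionTime
  refine ⟨regression, 21, P, fun d m B f _ _ => ⟨fun o ho => ?_, ?_⟩⟩
  · obtain ⟨o', ho', rfl⟩ := (PMF.mem_support_map_iff _ _ _).1 ho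
    rw [hP]
    exact (ensures_regression B f o' ho').2
  obtain ⟨Dopt, hDopt⟩ := exists_forall_regressionCost_le B f
  refine ⟨Dopt, hDopt, ?_⟩
  rw [Program.result, PMF.toOuterMeasure_map_apply]
  by_cases hd : d = 0
  · -- all matrices are empty, and every output is optimal
    subst hd
    have hzero : ∀ D, regressionCost B f D = 0 := fun D => by
      rw [regressionCost_eq_norm, Subsingleton.elim (target B - designMap 0 f D) 0, norm_zero]
    refine le_trans ?_ (le_of_eq ((PMF.toOuterMeasure_apply_eq_one_iff _ _).2
      fun o _ => ?_).symm)
    · rw [ENNReal.div_le_iff (by norm_num) (by norm_num)]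
      norm_num
    · simp [hzero]
  · have h := one_le_toOuterMeasure_regression_add hd B f Dopt
    refine ENNReal.le_of_add_le_add_right (a := ENNReal.ofReal (1 / 100)) (by simp)
      (le_trans (le_of_eq ?_) h)
    rw [show (99 / 100 : ENNReal) = ENNReal.ofReal (99 / 100) by
      rw [ENNReal.ofReal_div_of_pos (by norm_num)]; simp,
      ← ENNReal.ofReal_add (by norm_num) (by norm_num)]
    norm_num
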